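/- Let $H$ be a complex Hilbert space with inner product $\langle\cdot,\cdot\rangle$ (anti-linear on the left, linear on the right), and let $x\mapsto\bar x$ be a self-adjoint involution on $H$, i.e. a complex-linear map with $\langle \bar x,y\rangle=\langle x,\bar y\rangle$ and $\bar{\bar x}=x$. Let $\alpha,q\in(-1,1)$. Let $\Sigma(n)$ be the group of bijections $\sigma$ of $\{\pm1,\dots,\pm n\}$ with $\sigma(-k)=-\sigma(k)$, generated by $\pi_0=(1,-1)$ and $\pi_i=(i,i+1)$, $1\le i\le n-1$ (exchanging also $-i$ and $-(i+1)$). It acts on the algebraic tensor power $H^{\otimes n}$: $\pi_0$ replaces the first factor $x_1$ by $\overline{x_1}$, and $\pi_i$ exchanges the $i$-th and $(i+1)$-st factors. For $\sigma\in\Sigma(n)$ let $l_1(\sigma)$ be the number of $\pi_0$'s and $l_2(\sigma)$ the number of $\pi_i$'s with $i\ge1$ in a word of minimal length in the generators representing $\sigma$ (they do not depend on the word). On the algebraic full Fock space $\mathcal F(H)=\bigoplus_{n\ge0}H^{\otimes n}$ (finite sums, $H^{\otimes0}=\mathbb C\Omega$) let $\langle\cdot,\cdot\rangle_{0,0}$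 be the inner product with $\langle x_1\otimes\cdots\otimes x_m,y_1\otimes\cdots\otimes y_n\rangle_{0,0}=\delta_{m,n}\prod_{i=1}^n\langle x_i,y_i\rangle$, and let $$P_{\alpha,q}=\bigoplus_{n\ge0}P^{(n)}_{\alpha,q},\qquad P^{(n)}_{\alpha,q}=\sum_{\sigma\in\Sigma(n)}\alpha^{l_1(\sigma)}q^{l_2(\sigma)}\,\sigma\quad(0^0=1),\qquad \langle f,g\rangle_{\alpha,q}=\langle f,P_{\alpha,q}\,g\rangle_{0,0}.$$ For $x\in H$ let $b^*(x)$ be the creation operator on $\mathcal F(H)$: $b^*(x)(x_1\otimes\cdots\otimes x_n)=x_1\otimes\cdots\otimes x_n\otimes x$, $b^*(x)\Omega=x$. **Theorem.** The form $\langle\cdot,\cdot\rangle_{\alpha,q}$ is an inner product on $\mathcal F(H)$. Let $x\in H$, $x\ne0$ (the number $\langle x,\bar x\rangle$ is real). Then $b^*(x)$ is bounded for the norm $\|f\|_{\alpha,q}=\sqrt{\langle f,f\rangle_{\alpha,q}}$, and its operator norm $\|b^*(x)\|_{\alpha,q}$ satisfies: 1. If $-1<q\le0$ and $\alpha\langle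 x,\bar x\rangle\ge0$, then $\|b^*(x)\|_{\alpha,q}=\sqrt{\|x\|^2+\alpha\langle x,\bar x\rangle}$. 2. If $-1<q\le0$ and $\alpha\langle x,\bar x\rangle<0$, then $\dfrac{\|x\|}{\sqrt{1-q}}\le\|b^*(x)\|_{\alpha,q}\le\|x\|$. 3. If $|\alpha|\le q<1$, then $\|b^*(x)\|_{\alpha,q}=\dfrac{\|x\|}{\sqrt{1-q}}$. 4. If $0<q<\alpha\langle x,\bar x\rangle/\|x\|^2$, then $\dfrac{\|x\|}{\sqrt{1-q}}<\|b^*(x)\|_{\alpha,q}\le\sqrt{\dfrac{1+|\alpha|}{1-q}}\,\|x\|$. 5. In all other cases, $\dfrac{\|x\|}{\sqrt{1-q}}\le\|b^*(x)\|_{\alpha,q}\le\sqrt{\dfrac{1+|\alpha|}{1-q}}\,\|x\|$. -/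

import Mathlib

open scoped TensorProduct DirectSum ComplexConjugate

namespace TypeB

/-! ### The hyperoctahedral group -/

/-- `Σ(n)`: the group of bijections `σ` of the `2n` points `±1, …, ±n` with `σ(-k) = -σ(k)`.
The point `s·(i+1)` (for `i = 0, …, n-1` and a sign `s = ±1`) is encoded as the pair `(i, s)`. -/
def hyperoctahedral (n : ℕ) : Subgroup (Equiv.Perm (Fin n × ℤˣ)) where
  carrier := {σ | ∀ i s, σ (i, -s) = ((σ (i, s)).1, -(σ (i, s)).2)}
  one_mem' := fun _ _ => rfl
  mul_mem' := by
    intro σ τ hσ hτ i s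
    rw [Equiv.Perm.mul_apply, hτ, hσ]
    rfl
  inv_mem' := by
    intro σ hσ i s
    rw [Equiv.Perm.inv_eq_iff_eq, hσ]
    simp

noncomputable instance (n : ℕ) : Fintype (hyperoctahedral n) := Fintype.ofFinite _

/-- The Coxeter generators `π_0 = (1, -1)` and `π_i = (i, i+1)` (which also exchanges `-i` and
`-(i+1)`) for `1 ≤ i ≤ n - 1`. -/
def generator {n : ℕ} (i : Fin n) : hyperoctahedral n :=
  if i.val = 0 then
    ⟨Equiv.swap (i, 1) (i, -1), by
      intro j s
      by_cases hj : j = i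
      · subst hj
        rcases Int.units_eq_one_or s with rfl | rfl <;> simp
      · rw [Equiv.swap_apply_of_ne_of_ne, Equiv.swap_apply_of_ne_of_ne] <;> simp [hj]⟩
  else
    ⟨(Equiv.swap (⟨i.val - 1, by omega⟩ : Fin n) i).prodCongr (Equiv.refl ℤˣ), fun _ _ => rfl⟩

/-- The product `π_{i_1} ⋯ π_{i_k}` of a word in the generators. -/
def wordProd {n : ℕ} (w : List (Fin n)) : hyperoctahedral n := (w.map generator).prod

/-- `w` is an irreducible form of `σ`: a word of minimal length with product `σ`. -/
def IsReducedWord {n : ℕ} (σ : hyperoctahedral n) (w : List (Fin n)) : Prop :=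
  wordProd w = σ ∧ ∀ w', wordProd w' = σ → w.length ≤ w'.length

/-- `l₁(σ)`: the number of occurrences of `π_0` in an irreducible form of `σ`
(all irreducible forms have the same number of them). -/
noncomputable def l₁ {n : ℕ} (σ : hyperoctahedral n) : ℕ :=
  sInf {k | ∃ w, IsReducedWord σ w ∧ k = w.countP (fun i => i.val = 0)}

/-- `l₂(σ)`: the number of occurrences of `π_1, …, π_{n-1}` in an irreducible form of `σ`
(all irreducible forms have the same number of them). -/
noncomputable def l₂ {n : ℕ} (σ : hyperoctahedral n) : ℕ :=
  sInf {k | ∃ w, IsReducedWord σ w ∧ k = w.countP (fun i => i.val ≠ 0)}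

theorem fst_apply {n : ℕ} (σ : hyperoctahedral n) (p : Fin n × ℤˣ) :
    (σ.1 (p.1, 1)).1 = (σ.1 p).1 := by
  obtain ⟨i, s⟩ := p
  rcases Int.units_eq_one_or s with rfl | rfl
  · rfl
  · rw [σ.2 i 1]

/-- The permutation `j ↦ |σ(j)|` of the positions underlying `σ`. -/
def absPerm {n : ℕ} (σ : hyperoctahedral n) : Equiv.Perm (Fin n) where
  toFun i := (σ.1 (i, 1)).1
  invFun i := (σ⁻¹.1 (i, 1)).1
  left_inv i := by
    change (σ⁻¹.1 ((σ.1 (i, 1)).1, 1)).1 = i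
    rw [fst_apply]
    simp
  right_inv i := by
    change (σ.1 ((σ⁻¹.1 (i, 1)).1, 1)).1 = i
    rw [fst_apply]
    simp

/-! ### The algebraic full Fock space and its free inner product -/

section Fock

variable {H : Type*} [NormedAddCommGroup H] [InnerProductSpace ℂ H]

/-- The linear functional `y_1 ⊗ ⋯ ⊗ y_n ↦ ∏ ⟨x_i, y_i⟩` on the algebraic tensor power. -/
noncomputable def prodInner {n : ℕ} (x : Fin n → H) : (⨂[ℂ]^n H) →ₗ[ℂ] ℂ :=
  PiTensorProduct.lift
    ((MultilinearMap.mkPiAlgebra ℂ (Fin n) ℂ).compLinearMap fun i => innerₛₗ ℂ (x i))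

theorem prodInner_tprod {n : ℕ} (x y : Fin n → H) :
    prodInner x (PiTensorProduct.tprod ℂ y) = ∏ i, inner ℂ (x i) (y i) := by
  simp [prodInner]

theorem prodInner_tprod_conj {n : ℕ} (x y : Fin n → H) :
    prodInner x (PiTensorProduct.tprod ℂ y) = conj (prodInner y (PiTensorProduct.tprod ℂ x)) := by
  simp [prodInner_tprod]

/-- The inner product on `H^{⊗n}` (anti-linear on the left, linear on the right), determined by
`⟨x_1 ⊗ ⋯ ⊗ x_n, y_1 ⊗ ⋯ ⊗ y_n⟩_{0,0} = ∏ ⟨x_i, y_i⟩`. -/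
noncomputable def tensorInner (n : ℕ) : (⨂[ℂ]^n H) →ₗ⋆[ℂ] (⨂[ℂ]^n H) →ₗ[ℂ] ℂ :=
  let A : (⨂[ℂ]^n H) →+ ((⨂[ℂ]^n H) →ₗ[ℂ] ℂ) :=
    PiTensorProduct.liftAddHom (fun p => conj p.1 • prodInner p.2)
      (fun r f i hf => by
        apply PiTensorProduct.ext; ext y
        simp [prodInner_tprod_conj f, (PiTensorProduct.tprod ℂ).map_coord_zero i hf])
      (fun f => by simp)
      (fun r f i m₁ m₂ => by
        apply PiTensorProduct.ext; ext y
        simp [prodInner_tprod_conj _ y, mul_add])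
      (fun r r' f => by simp [add_smul])
      (fun r f i r' => by
        apply PiTensorProduct.ext; ext y
        simp [prodInner_tprod_conj _ y]
        ring)
  { A with
    map_smul' := by
      intro c u
      change A (c • u) = conj c • A u
      induction u using PiTensorProduct.induction_on with
      | smul_tprod r f =>
        have hA : ∀ z : ℂ, A (z • PiTensorProduct.tprod ℂ f) = conj z • prodInner f := by
          intro z
          rw [← PiTensorProduct.tprodCoeff_eq_smul_tprod]
          rfl
        rw [smul_smul, hA, hA, smul_smul, map_mul]
      | add u v hu hv => rw [smul_add, map_add, hu, hv, map_add, smul_add] }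

theorem tensorInner_tprod {n : ℕ} (x y : Fin n → H) :
    tensorInner n (PiTensorProduct.tprod ℂ x) (PiTensorProduct.tprod ℂ y)
      = ∏ i, inner ℂ (x i) (y i) := by
  rw [← prodInner_tprod, PiTensorProduct.tprod_eq_tprodCoeff_one]
  change (conj (1 : ℂ) • prodInner x) _ = _
  simp

variable (H) in
/-- The algebraic full Fock space `⨁_{n ≥ 0} H^{⊗n}` (algebraic tensor powers, finite sums);
the vacuum `Ω` is the empty tensor in degree `0`. -/
abbrev FockSpace : Type _ := ⨁ n : ℕ, ⨂[ℂ]^n H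

/-- The free inner product `⟨·, ·⟩_{0,0}`: the orthogonal direct sum of the inner products of the
`H^{⊗n}`. -/
noncomputable def freeInner (f g : FockSpace H) : ℂ :=
  open Classical in DFinsupp.sum f fun n u => tensorInner n u (g n)

/-! ### The deformed inner product -/

/-- The action of `σ ∈ Σ(n)` on `H^{⊗n}` defined by the involution `J`: with `x_{-k} := J x_k`, it
sends `x_1 ⊗ ⋯ ⊗ x_n` to `x_{σ⁻¹(1)} ⊗ ⋯ ⊗ x_{σ⁻¹(n)}`. (First apply `J` to those `x_j` for which
`σ(j)` is negative, then move the `j`-th factor to position `|σ(j)|`.) -/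
noncomputable def action (J : H →ₗ[ℂ] H) {n : ℕ} (σ : hyperoctahedral n) :
    (⨂[ℂ]^n H) →ₗ[ℂ] (⨂[ℂ]^n H) :=
  (PiTensorProduct.reindex ℂ (fun _ => H) (absPerm σ)).toLinearMap ∘ₗ
    PiTensorProduct.map fun j => if (σ.1 (j, 1)).2 = 1 then LinearMap.id else J

/-- The type B symmetrization operator
`P_{α,q}^{(n)} = ∑_{σ ∈ Σ(n)} α^{l₁(σ)} q^{l₂(σ)} σ` on `H^{⊗n}`. -/
noncomputable def symmetrization (J : H →ₗ[ℂ] H) (α q : ℝ) (n : ℕ) :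
    (⨂[ℂ]^n H) →ₗ[ℂ] (⨂[ℂ]^n H) :=
  ∑ σ : hyperoctahedral n, ((α ^ l₁ σ * q ^ l₂ σ : ℝ) : ℂ) • action J σ

/-- `P_{α,q} = ⨁_n P_{α,q}^{(n)}` on the algebraic full Fock space. -/
noncomputable def fockSymmetrization (J : H →ₗ[ℂ] H) (α q : ℝ) : FockSpace H →ₗ[ℂ] FockSpace H :=
  DirectSum.lmap fun n => symmetrization J α q n

/-- The deformed inner product `⟨f, g⟩_{α,q} = ⟨f, P_{α,q} g⟩_{0,0}`. -/
noncomputable def deformedInner (J : H →ₗ[ℂ] H) (α q : ℝ) (f g : FockSpace H) : ℂ :=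
  freeInner f (fockSymmetrization J α q g)

/-- The norm `‖f‖_{α,q} = √⟨f, f⟩_{α,q}`. -/
noncomputable def fockNorm (J : H →ₗ[ℂ] H) (α q : ℝ) (f : FockSpace H) : ℝ :=
  Real.sqrt (deformedInner J α q f f).re

/-! ### Creation operators and operator norms -/

/-- The creation operator `b*(x)`: the linear map
`x_1 ⊗ ⋯ ⊗ x_n ↦ x_1 ⊗ ⋯ ⊗ x_n ⊗ x` (in particular `Ω ↦ x`). -/
noncomputable def creation (x : H) : FockSpace H →ₗ[ℂ] FockSpace H :=
  DirectSum.toModule ℂ ℕ (FockSpace H) fun n =>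
    DirectSum.lof ℂ ℕ (fun m => ⨂[ℂ]^m H) (n + 1) ∘ₗ
      PiTensorProduct.lift ((LinearMap.applyₗ x).compMultilinearMap
        (PiTensorProduct.tprod ℂ : MultilinearMap ℂ (fun _ : Fin (n + 1) => H) _).curryRight)

/-- `T` is bounded for the norm `‖·‖_{α,q}`. -/
def IsBoundedOp (J : H →ₗ[ℂ] H) (α q : ℝ) (T : FockSpace H →ₗ[ℂ] FockSpace H) : Prop :=
  ∃ c : ℝ, ∀ f, fockNorm J α q (T f) ≤ c * fockNorm J α q f

/-- The operator norm `‖T‖_{α,q}` of a bounded operator `T` on the Fock space with the norm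
`‖·‖_{α,q}`: the least `c ≥ 0` with `‖T f‖_{α,q} ≤ c ‖f‖_{α,q}` for all `f`. -/
noncomputable def opNorm (J : H →ₗ[ℂ] H) (α q : ℝ) (T : FockSpace H →ₗ[ℂ] FockSpace H) : ℝ :=
  sInf {c : ℝ | 0 ≤ c ∧ ∀ f, fockNorm J α q (T f) ≤ c * fockNorm J α q f}

end Fock

end TypeB

/-!
Let `N σ` be the set of positive roots of type B on which `σ⁻¹` is increasing. The coefficient of
`σ⁻¹ τ` in the symmetrization is the product of `α` (short roots) and `q` (long roots) over the
symmetric difference of `N σ` and `N τ`, hence a product of one two-valued kernel for each root.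
Each factor is a convex combination of the indicator of "same side" and a rank-one kernel, with
a positive coefficient on the former, so the product dominates a positive multiple of the identity
kernel. This makes the deformed form positive definite.

Minimal representatives of the cosets of `Σ(n)` in `Σ(n + 1)` factor the symmetrization as
`P^(n+1) = (P^(n) ⊗ 1) R`, which yields an explicit adjoint `b(x)` of `b*(x)` with
`b(x) b*(y) = q b*(y) b(x) + ⟨x, y⟩ + α ⟨x, J y⟩ q^{2N}`, `N` being the degree. The upper bounds on
`‖b*(x)‖` follow: for `q ≤ 0` the first term only helps, and for `q ≥ 0` one inducts on the degree,
bounding `b(x)` by its adjoint one degree lower. The lower bounds come from the vectors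
`x ⊗ ⋯ ⊗ x`, on which `b*(x)` multiplies the squared norm by `[n + 1]_q (‖x‖² + α ⟨x, J x⟩ q^n)`.
-/

namespace TypeB

/-! ### Signed points, roots and chambers -/

section Roots

open scoped symmDiff

variable {n : ℕ}

/-- The signed integer `s (i + 1)` encoded by the pair `(i, s)`. -/
def signedVal (p : Fin n × ℤˣ) : ℤ := p.2 * (p.1.val + 1)

@[simp] theorem signedVal_one (i : Fin n) : signedVal (i, 1) = i.val + 1 := by
  simp [signedVal]

@[simp] theorem signedVal_neg (i : Fin n) (s : ℤˣ) : signedVal (i, -s) = -signedVal (i, s) := by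
  simp [signedVal]

theorem signedVal_injective : Function.Injective (signedVal (n := n)) := by
  rintro ⟨i, s⟩ ⟨j, t⟩ h
  rcases Int.units_eq_one_or s with rfl | rfl <;> rcases Int.units_eq_one_or t with rfl | rfl <;>
    simp [Fin.ext_iff] at h ⊢ <;> omega

theorem signedVal_ne_zero (p : Fin n × ℤˣ) : signedVal p ≠ 0 := by
  obtain ⟨i, s⟩ := p
  rcases Int.units_eq_one_or s with rfl | rfl <;> simp <;> omega

/-- The point `-p`. -/
def opp (p : Fin n × ℤˣ) : Fin n × ℤˣ := (p.1, -p.2)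

@[simp] theorem signedVal_opp (p : Fin n × ℤˣ) : signedVal (opp p) = -signedVal p :=
  signedVal_neg p.1 p.2

theorem apply_opp (σ : hyperoctahedral n) (p : Fin n × ℤˣ) : σ.1 (opp p) = opp (σ.1 p) :=
  σ.2 p.1 p.2

theorem fst_eq_iff (p r : Fin n × ℤˣ) : p.1 = r.1 ↔ p = r ∨ p = opp r := by
  obtain ⟨i, s⟩ := p
  obtain ⟨j, t⟩ := r
  rcases Int.units_eq_one_or s with rfl | rfl <;> rcases Int.units_eq_one_or t with rfl | rfl <;>
    simp [opp]

theorem fst_apply_eq_iff (σ : hyperoctahedral n) (p r : Fin n × ℤˣ) :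
    (σ.1 p).1 = (σ.1 r).1 ↔ p.1 = r.1 := by
  rw [fst_eq_iff, fst_eq_iff, ← apply_opp, σ.1.injective.eq_iff, σ.1.injective.eq_iff]

/-- A positive root of type B, encoded as a pair of points `p < p'` with `p + p' ≥ 0`. -/
abbrev Root (n : ℕ) : Type :=
  {t : (Fin n × ℤˣ) × (Fin n × ℤˣ) //
    signedVal t.1 < signedVal t.2 ∧ 0 ≤ signedVal t.1 + signedVal t.2}

/-- A root is short when it is a multiple of a coordinate vector, i.e. a pair `(-p, p)`. -/
abbrev IsShort (t : Root n) : Prop := t.1.1.1 = t.1.2.1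

/-- Two pairs of points represent the same root up to sign: the orders of the two pairs determine
each other in every image under the hyperoctahedral group. -/
def SameRoot (p r : (Fin n × ℤˣ) × (Fin n × ℤˣ)) : Prop :=
  p = r ∨ p = (r.2, r.1) ∨ p = (opp r.1, opp r.2) ∨ p = (opp r.2, opp r.1)

theorem exists_sameRoot {a b : Fin n × ℤˣ} (h : a ≠ b) : ∃ t : Root n, SameRoot t.1 (a, b) := by
  have hv : signedVal a ≠ signedVal b := signedVal_injective.ne h
  rcases lt_or_gt_of_ne hv with h1 | h1 <;>
    rcases le_or_gt 0 (signedVal a + signedVal b) with h2 | h2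
  · exact ⟨⟨(a, b), h1, h2⟩, by simp [SameRoot]⟩
  · exact ⟨⟨(opp b, opp a), by simp; omega⟩, by simp [SameRoot]⟩
  · exact ⟨⟨(b, a), h1, by rwa [add_comm]⟩, by simp [SameRoot]⟩
  · exact ⟨⟨(opp a, opp b), by simp; omega⟩, by simp [SameRoot]⟩

theorem SameRoot.eq {t t' : Root n} {p : (Fin n × ℤˣ) × (Fin n × ℤˣ)}
    (h : SameRoot t.1 p) (h' : SameRoot t'.1 p) : t = t' := by
  obtain ⟨⟨a, b⟩, hab⟩ := t
  obtain ⟨⟨c, d⟩, hcd⟩ := t'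
  simp only [SameRoot, Subtype.mk.injEq, Prod.ext_iff, ← signedVal_injective.eq_iff,
    signedVal_opp] at h h' hab hcd ⊢
  omega

theorem SameRoot.fst_eq_iff {p r : (Fin n × ℤˣ) × (Fin n × ℤˣ)} (h : SameRoot p r) :
    p.1.1 = p.2.1 ↔ r.1.1 = r.2.1 := by
  rcases h with rfl | rfl | rfl | rfl <;> simp [opp, eq_comm]

theorem sameRoot_inv_apply (σ : hyperoctahedral n) {a b c d : Fin n × ℤˣ} :
    SameRoot (σ⁻¹.1 a, σ⁻¹.1 b) (c, d) ↔ SameRoot (a, b) (σ.1 c, σ.1 d) := by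
  have inv_apply_eq (p r) : σ⁻¹.1 p = r ↔ p = σ.1 r := Equiv.Perm.inv_eq_iff_eq
  simp only [SameRoot, Prod.mk.injEq, inv_apply_eq, apply_opp]

theorem SameRoot.lt_iff_lt_iff {p r : (Fin n × ℤˣ) × (Fin n × ℤˣ)} (h : SameRoot p r)
    (hr : r.1 ≠ r.2) (ρ ρ' : hyperoctahedral n) :
    (signedVal (ρ.1 p.1) < signedVal (ρ.1 p.2) ↔ signedVal (ρ'.1 p.1) < signedVal (ρ'.1 p.2)) ↔
      (signedVal (ρ.1 r.1) < signedVal (ρ.1 r.2) ↔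
        signedVal (ρ'.1 r.1) < signedVal (ρ'.1 r.2)) := by
  have hρ : signedVal (ρ.1 r.1) ≠ signedVal (ρ.1 r.2) :=
    (signedVal_injective.comp ρ.1.injective).ne hr
  have hρ' : signedVal (ρ'.1 r.1) ≠ signedVal (ρ'.1 r.2) :=
    (signedVal_injective.comp ρ'.1.injective).ne hr
  rcases h with rfl | rfl | rfl | rfl <;> simp only [apply_opp, signedVal_opp] <;> omega

/-- The chamber of `σ`, as the set of positive roots on which `σ⁻¹` is increasing; two chambers
are separated by the hyperplanes of the roots in their symmetric difference. -/
def chamber (σ : hyperoctahedral n) : Finset (Root n) :=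
  {t | signedVal (σ⁻¹.1 t.1.1) < signedVal (σ⁻¹.1 t.1.2)}

theorem mem_chamber {σ : hyperoctahedral n} {t : Root n} :
    t ∈ chamber σ ↔ signedVal (σ⁻¹.1 t.1.1) < signedVal (σ⁻¹.1 t.1.2) := by
  simp [chamber]

theorem mem_chamber_symmDiff {σ τ : hyperoctahedral n} {t : Root n} :
    t ∈ chamber σ ∆ chamber τ ↔ ¬ (signedVal (σ⁻¹.1 t.1.1) < signedVal (σ⁻¹.1 t.1.2) ↔
      signedVal (τ⁻¹.1 t.1.1) < signedVal (τ⁻¹.1 t.1.2)) := by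
  rw [Finset.mem_symmDiff, mem_chamber, mem_chamber]
  tauto

/-! ### Generators cross one wall -/

/-- The pair of points exchanged by a generator. -/
def wall (i : Fin n) : (Fin n × ℤˣ) × (Fin n × ℤˣ) :=
  if i.val = 0 then ((i, -1), (i, 1)) else ((⟨i.val - 1, by omega⟩, 1), (i, 1))

theorem signedVal_wall_fst (i : Fin n) :
    signedVal (wall i).1 = if i.val = 0 then -1 else (i.val : ℤ) := by
  unfold wall
  split_ifs with h
  · simp [h]
  · simp; omega

theorem signedVal_wall_snd (i : Fin n) : signedVal (wall i).2 = i.val + 1 := by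
  unfold wall
  split_ifs <;> simp

theorem signedVal_wall_fst_lt_snd (i : Fin n) :
    signedVal (wall i).1 < signedVal (wall i).2 := by
  rw [signedVal_wall_fst, signedVal_wall_snd]
  split_ifs <;> omega

theorem wall_fst_ne_snd (i : Fin n) : (wall i).1 ≠ (wall i).2 :=
  fun h => (signedVal_wall_fst_lt_snd i).ne (congrArg signedVal h)

theorem fst_wall_eq_iff (i : Fin n) : (wall i).1.1 = (wall i).2.1 ↔ i.val = 0 := by
  unfold wall
  split_ifs with h <;> simp [h, Fin.ext_iff]
  omega

theorem signedVal_generator (i : Fin n) (p : Fin n × ℤˣ) :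
    signedVal ((generator i).1 p) =
      if signedVal p = signedVal (wall i).1 then signedVal (wall i).2
      else if signedVal p = signedVal (wall i).2 then signedVal (wall i).1
      else if signedVal p = -signedVal (wall i).1 then -signedVal (wall i).2
      else if signedVal p = -signedVal (wall i).2 then -signedVal (wall i).1
      else signedVal p := by
  by_cases h : i.val = 0
  · have apply_eq : (generator i).1 p = Equiv.swap (i, 1) (i, -1) p := by simp [generator, h]
    have wall_eq : wall i = ((i, -1), (i, 1)) := by simp [wall, h]
    rw [apply_eq, wall_eq, Equiv.swap_apply_def]
    simp only [← signedVal_injective.eq_iff, apply_ite signedVal, signedVal_neg]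
    split_ifs <;> omega
  · have apply_eq : (generator i).1 p =
        (Equiv.swap (⟨i.val - 1, by omega⟩ : Fin n) i p.1, p.2) := by
      simp only [generator, h, if_false]
      rfl
    have wall_eq : wall i = ((⟨i.val - 1, by omega⟩, 1), (i, 1)) := by simp [wall, h]
    rw [apply_eq, wall_eq, Equiv.swap_apply_def]
    obtain ⟨j, s⟩ := p
    simp only [Fin.ext_iff]
    rcases Int.units_eq_one_or s with rfl | rfl <;> simp only [signedVal_neg, signedVal_one] <;>
    · split_ifs <;> simp <;> omega

theorem generator_mul_self (i : Fin n) : generator i * generator i = 1 := by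
  apply Subtype.ext
  ext1 p
  apply signedVal_injective
  change signedVal ((generator i).1 ((generator i).1 p)) = signedVal p
  rw [signedVal_generator, signedVal_generator, signedVal_wall_fst, signedVal_wall_snd]
  split_ifs <;> omega

theorem generator_inv (i : Fin n) : (generator i)⁻¹ = generator i :=
  inv_eq_of_mul_eq_one_left (generator_mul_self i)

theorem generator_reverses_iff (i : Fin n) {a b : Fin n × ℤˣ} (h : a ≠ b) :
    ¬ (signedVal a < signedVal b ↔
      signedVal ((generator i).1 a) < signedVal ((generator i).1 b)) ↔
      SameRoot (a, b) (wall i) := by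
  have ha := signedVal_ne_zero a
  have hb := signedVal_ne_zero b
  rw [signedVal_generator, signedVal_generator]
  simp only [SameRoot, ne_eq, Prod.ext_iff, ← signedVal_injective.eq_iff, signedVal_opp,
    signedVal_wall_fst, signedVal_wall_snd] at h ⊢
  generalize signedVal a = x at *
  generalize signedVal b = y at *
  split_ifs <;> omega

theorem exists_chamber_symmDiff_mul_generator (σ : hyperoctahedral n) (i : Fin n) :
    ∃ t : Root n, SameRoot t.1 (σ.1 (wall i).1, σ.1 (wall i).2) ∧
      chamber σ ∆ chamber (σ * generator i) = {t} := by
  obtain ⟨t, ht⟩ := exists_sameRoot (σ.1.injective.ne (wall_fst_ne_snd i))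
  refine ⟨t, ht, ?_⟩
  ext t'
  have inv_ne : σ⁻¹.1 t'.1.1 ≠ σ⁻¹.1 t'.1.2 :=
    σ⁻¹.1.injective.ne fun h => t'.2.1.ne (congrArg signedVal h)
  have mul_inv_apply (p) : (σ * generator i)⁻¹.1 p = (generator i).1 (σ⁻¹.1 p) := by
    rw [mul_inv_rev, generator_inv]
    rfl
  rw [Finset.mem_singleton, mem_chamber_symmDiff, mul_inv_apply, mul_inv_apply,
    generator_reverses_iff i inv_ne, sameRoot_inv_apply]
  exact ⟨fun h => h.eq ht, fun h => h ▸ ht⟩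

theorem isShort_iff_of_sameRoot_wall {σ : hyperoctahedral n} {i : Fin n} {t : Root n}
    (ht : SameRoot t.1 (σ.1 (wall i).1, σ.1 (wall i).2)) : IsShort t ↔ i.val = 0 := by
  rw [IsShort, ht.fst_eq_iff, fst_apply_eq_iff, fst_wall_eq_iff]

theorem mem_chamber_symmDiff_of_sameRoot_wall {σ : hyperoctahedral n} {i : Fin n} {t : Root n}
    (ht : SameRoot t.1 (σ.1 (wall i).1, σ.1 (wall i).2)) (τ : hyperoctahedral n) :
    t ∈ chamber σ ∆ chamber τ ↔
      ¬ signedVal ((τ⁻¹ * σ).1 (wall i).1) < signedVal ((τ⁻¹ * σ).1 (wall i).2) := by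
  have inv_apply_self (p) : σ⁻¹.1 (σ.1 p) = p := σ.1.symm_apply_apply p
  rw [mem_chamber_symmDiff, ht.lt_iff_lt_iff (σ.1.injective.ne (wall_fst_ne_snd i)),
    inv_apply_self, inv_apply_self, iff_true_left (signedVal_wall_fst_lt_snd i)]
  rfl

/-! ### Length as a count of separating roots -/

theorem signedVal_le (p : Fin n × ℤˣ) : signedVal p ≤ n := by
  obtain ⟨i, s⟩ := p
  rcases Int.units_eq_one_or s with rfl | rfl
  · simp only [signedVal_one]
    omega
  · simp only [signedVal_neg, signedVal_one]
    omega

theorem ext_of_apply_one {σ τ : hyperoctahedral n} (h : ∀ i, σ.1 (i, 1) = τ.1 (i, 1)) :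
    σ = τ := by
  apply Subtype.ext
  ext1 ⟨i, s⟩
  rcases Int.units_eq_one_or s with rfl | rfl
  · exact h i
  · exact (apply_opp σ (i, 1)).trans ((congrArg opp (h i)).trans (apply_opp τ (i, 1)).symm)

theorem eq_one_of_wall_lt (ρ : hyperoctahedral n)
    (h : ∀ i : Fin n, signedVal (ρ.1 (wall i).1) < signedVal (ρ.1 (wall i).2)) : ρ = 1 := by
  have pos (hn : 0 < n) : 0 < signedVal (ρ.1 (⟨0, hn⟩, 1)) := by
    have h0 := h ⟨0, hn⟩
    have hopp := congrArg signedVal (apply_opp ρ (⟨0, hn⟩, 1))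
    rw [signedVal_opp] at hopp
    simp only [wall, opp, if_true] at h0 hopp
    omega
  have step (k : ℕ) (hk : k + 1 < n) :
      signedVal (ρ.1 (⟨k, by omega⟩, 1)) < signedVal (ρ.1 (⟨k + 1, hk⟩, 1)) := by
    simpa [wall] using h ⟨k + 1, hk⟩
  have lower (k : ℕ) (hk : k < n) : (k : ℤ) + 1 ≤ signedVal (ρ.1 (⟨k, hk⟩, 1)) := by
    induction k with
    | zero => simpa using Int.add_one_le_of_lt (pos hk)
    | succ k ih => have := ih (by omega); have := step k hk; push_cast; omega
  have upper (j k : ℕ) (hk : k + j + 1 = n) :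
      signedVal (ρ.1 (⟨k, by omega⟩, 1)) ≤ (k : ℤ) + 1 := by
    induction j generalizing k with
    | zero => have := signedVal_le (ρ.1 (⟨k, by omega⟩, 1)); omega
    | succ j ih =>
      have := ih (k + 1) (by omega)
      have := step k (by omega)
      push_cast at *
      omega
  refine ext_of_apply_one fun i => signedVal_injective ?_
  exact (le_antisymm (upper (n - 1 - i) i (by omega)) (lower i i.2)).trans (signedVal_one i).symm

theorem card_filter_chamber_symmDiff_le_countP (c : Root n → Prop) [DecidablePred c]
    (d : Fin n → Bool) (hcd : ∀ t i, (IsShort t ↔ i.val = 0) → (c t ↔ d i))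
    (w : List (Fin n)) (σ : hyperoctahedral n) :
    (Finset.filter c (chamber σ ∆ chamber (σ * wordProd w))).card ≤ w.countP d := by
  induction w generalizing σ with
  | nil => simp [wordProd]
  | cons i w ih =>
    have mul_wordProd_cons :
        σ * wordProd (i :: w) = σ * generator i * wordProd w := by
      simp [wordProd, mul_assoc]
    obtain ⟨t, ht, hcross⟩ := exists_chamber_symmDiff_mul_generator σ i
    have hct := hcd t i (isShort_iff_of_sameRoot_wall ht)
    rw [mul_wordProd_cons, List.countP_cons, add_comm]
    calc _ ≤ (Finset.filter c (chamber σ ∆ chamber (σ * generator i) ∪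
            chamber (σ * generator i) ∆ chamber (σ * generator i * wordProd w))).card :=
          Finset.card_le_card (Finset.filter_subset_filter _ (symmDiff_triangle _ _ _))
      _ ≤ (Finset.filter c {t}).card + _ := by
          rw [Finset.filter_union, hcross]
          exact Finset.card_union_le _ _
      _ ≤ _ := by
          refine add_le_add ?_ (ih _)
          rw [Finset.filter_singleton]
          simp only [hct, apply_ite Finset.card, Finset.card_singleton, Finset.card_empty, le_refl]

theorem exists_word_length_eq (σ τ : hyperoctahedral n) :
    ∃ w : List (Fin n), σ * wordProd w = τ ∧ w.length = (chamber σ ∆ chamber τ).card := by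
  generalize hk : (chamber σ ∆ chamber τ).card = k
  induction k generalizing σ with
  | zero =>
    have eq_one : τ⁻¹ * σ = 1 := eq_one_of_wall_lt _ fun i => by
      obtain ⟨t, ht, -⟩ := exists_chamber_symmDiff_mul_generator σ i
      by_contra hlt
      have hmem := (mem_chamber_symmDiff_of_sameRoot_wall ht τ).2 hlt
      simp [Finset.card_eq_zero.1 hk] at hmem
    exact ⟨[], by simp [wordProd, inv_mul_eq_one.1 eq_one], rfl⟩
  | succ k ih =>
    obtain ⟨i, hi⟩ : ∃ i : Fin n,
        ¬ signedVal ((τ⁻¹ * σ).1 (wall i).1) < signedVal ((τ⁻¹ * σ).1 (wall i).2) := by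
      by_contra! hall
      have hστ := inv_mul_eq_one.1 (eq_one_of_wall_lt _ hall)
      simp [hστ] at hk
    obtain ⟨t, ht, hcross⟩ := exists_chamber_symmDiff_mul_generator σ i
    have herase : chamber (σ * generator i) ∆ chamber τ = (chamber σ ∆ chamber τ).erase t := by
      have hmem := (mem_chamber_symmDiff_of_sameRoot_wall ht τ).2 hi
      rw [← symmDiff_symmDiff_cancel_left (chamber σ) (chamber (σ * generator i)), hcross,
        symmDiff_comm (chamber σ), symmDiff_assoc, Finset.erase_eq, symmDiff_def,
        sdiff_eq_bot_iff.2 (Finset.singleton_subset_iff.2 hmem), bot_sup_eq]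
    obtain ⟨w, hw, hlen⟩ := ih (σ * generator i) (by
      rw [herase, Finset.card_erase_of_mem ((mem_chamber_symmDiff_of_sameRoot_wall ht τ).2 hi), hk,
        Nat.add_sub_cancel])
    exact ⟨i :: w, by simp [← hw, wordProd, mul_assoc], by simp [hlen]⟩

theorem chamber_injective : Function.Injective (chamber (n := n)) := by
  intro σ τ h
  obtain ⟨w, hw, hlen⟩ := exists_word_length_eq σ τ
  rw [h, symmDiff_self, Finset.bot_eq_empty, Finset.card_empty, List.length_eq_zero_iff] at hlen
  simpa [hlen, wordProd] using hw

theorem card_chamber_symmDiff_le_length {σ τ : hyperoctahedral n} {w : List (Fin n)}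
    (hw : σ * wordProd w = τ) : (chamber σ ∆ chamber τ).card ≤ w.length := by
  simpa [hw] using
    card_filter_chamber_symmDiff_le_countP (fun _ => True) (fun _ => true) (by simp) w σ

theorem IsReducedWord.countP_eq {σ τ : hyperoctahedral n} {w : List (Fin n)}
    (hw : IsReducedWord (σ⁻¹ * τ) w) (c : Root n → Prop) [DecidablePred c]
    (d : Fin n → Bool) (hcd : ∀ t i, (IsShort t ↔ i.val = 0) → (c t ↔ d i)) :
    w.countP d = (Finset.filter c (chamber σ ∆ chamber τ)).card := by
  have hτ : σ * wordProd w = τ := by rw [hw.1, mul_inv_cancel_left]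
  have hlen : w.length ≤ (chamber σ ∆ chamber τ).card := by
    obtain ⟨w', hw', hlen'⟩ := exists_word_length_eq σ τ
    exact hlen' ▸ hw.2 w' (eq_inv_mul_of_mul_eq hw')
  have hpos := card_filter_chamber_symmDiff_le_countP c d hcd w σ
  have hneg := card_filter_chamber_symmDiff_le_countP (fun t => ¬ c t) (fun i => !d i)
    (fun t i h => by simp [hcd t i h]) w σ
  have hcard := Finset.card_filter_add_card_filter_not (s := chamber σ ∆ chamber τ) c
  have hsum := w.length_eq_countP_add_countP d
  simp only [hτ, Bool.not_eq_true, Bool.decide_eq_false] at hpos hneg hsum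
  omega

theorem sInf_countP_reducedWord (σ τ : hyperoctahedral n) (c : Root n → Prop) [DecidablePred c]
    (d : Fin n → Bool) (hcd : ∀ t i, (IsShort t ↔ i.val = 0) → (c t ↔ d i)) :
    sInf {k | ∃ w, IsReducedWord (σ⁻¹ * τ) w ∧ k = w.countP d} =
      (Finset.filter c (chamber σ ∆ chamber τ)).card := by
  obtain ⟨w, hw, hlen⟩ := exists_word_length_eq σ τ
  have hreduced : IsReducedWord (σ⁻¹ * τ) w := ⟨eq_inv_mul_of_mul_eq hw, fun w' hw' =>
    hlen.trans_le (card_chamber_symmDiff_le_length (by rw [hw', mul_inv_cancel_left]))⟩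
  have hset : {k | ∃ w, IsReducedWord (σ⁻¹ * τ) w ∧ k = w.countP d} =
      {(Finset.filter c (chamber σ ∆ chamber τ)).card} := by
    ext k
    exact ⟨fun ⟨w, hw, hk⟩ => hk.trans (hw.countP_eq c d hcd),
      fun hk => ⟨w, hreduced, hk.trans (hreduced.countP_eq c d hcd).symm⟩⟩
  rw [hset, csInf_singleton]

/-- The parameter attached to a root: `α` for the roots conjugate to the wall of `π_0`, `q` for
the others. -/
def rootParam (α q : ℝ) (t : Root n) : ℝ := if IsShort t then α else q

/-- The coefficient `α^{l₁(σ)} q^{l₂(σ)}` of `σ` in the symmetrization operator. -/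
noncomputable def weight (α q : ℝ) (σ : hyperoctahedral n) : ℝ := α ^ l₁ σ * q ^ l₂ σ

theorem weight_inv_mul (α q : ℝ) (σ τ : hyperoctahedral n) :
    weight α q (σ⁻¹ * τ) = ∏ t ∈ chamber σ ∆ chamber τ, rootParam α q t := by
  have h₁ : l₁ (σ⁻¹ * τ) = (Finset.filter IsShort (chamber σ ∆ chamber τ)).card :=
    sInf_countP_reducedWord σ τ IsShort _ fun t i h => by simpa using h
  have h₂ : l₂ (σ⁻¹ * τ) = (Finset.filter (fun t => ¬ IsShort t) (chamber σ ∆ chamber τ)).card :=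
    sInf_countP_reducedWord σ τ (fun t => ¬ IsShort t) _ fun t i h => by simpa using not_congr h
  rw [weight, h₁, h₂, ← Finset.prod_const, ← Finset.prod_const]
  exact (Finset.prod_ite _ _).symm

theorem weight_inv (α q : ℝ) (σ : hyperoctahedral n) : weight α q σ⁻¹ = weight α q σ := by
  have h := weight_inv_mul α q σ 1
  rwa [symmDiff_comm, ← weight_inv_mul, mul_one, inv_one, one_mul] at h

end Roots

/-! ### Strict positivity of product kernels -/

section Kernel

open scoped symmDiff

variable {ι T V : Type*} [AddCommGroup V] [Module ℂ V]

/-- The kernel equal to `1` where `p` agrees and to `c` where it does not. -/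
def agreeKernel (p : ι → Prop) [DecidablePred p] (c : ℝ) (a b : ι) : ℝ :=
  if p a ↔ p b then 1 else c

-- A convex combination of the kernel at `c = 0` and of the rank-one kernel at the sign of `c`.
theorem agreeKernel_eq (p : ι → Prop) [DecidablePred p] (c : ℝ) :
    ∃ δ : ι → ℝ, ∀ a b, agreeKernel p c a b =
      (1 - |c|) * agreeKernel p 0 a b + |c| * (δ a * δ b) := by
  refine ⟨fun a => if 0 ≤ c ∨ p a then 1 else -1, fun a b => ?_⟩
  rcases le_or_gt 0 c with h | h
  · by_cases ha : p a <;> by_cases hb : p b <;> simp [agreeKernel, ha, hb, h, abs_of_nonneg h]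
  · by_cases ha : p a <;> by_cases hb : p b <;>
      simp [agreeKernel, ha, hb, not_le.2 h, abs_of_neg h]

variable [Fintype ι]

/-- The kernel `k` is positive semidefinite with respect to the sesquilinear form `B`. -/
def IsPosKernel (B : V →ₗ⋆[ℂ] V →ₗ[ℂ] ℂ) (k : ι → ι → ℝ) : Prop :=
  ∀ F : ι → V, 0 ≤ ∑ a, ∑ b, k a b * (B (F a) (F b)).re

namespace IsPosKernel

variable {B : V →ₗ⋆[ℂ] V →ₗ[ℂ] ℂ} {k k' : ι → ι → ℝ}

theorem add (hk : IsPosKernel B k) (hk' : IsPosKernel B k') :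
    IsPosKernel B fun a b => k a b + k' a b := fun F => by
  simpa only [add_mul, Finset.sum_add_distrib] using add_nonneg (hk F) (hk' F)

theorem const_mul (hk : IsPosKernel B k) {r : ℝ} (hr : 0 ≤ r) :
    IsPosKernel B fun a b => r * k a b := fun F => by
  simpa only [mul_assoc, Finset.mul_sum] using mul_nonneg hr (hk F)

theorem outer_mul (hk : IsPosKernel B k) (φ : ι → ℝ) :
    IsPosKernel B fun a b => φ a * φ b * k a b := fun F => by
  convert hk fun a => (φ a : ℂ) • F a using 1
  refine Finset.sum_congr rfl fun a _ => Finset.sum_congr rfl fun b _ => ?_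
  simp only [map_smulₛₗ, LinearMap.smul_apply, Complex.conj_ofReal, smul_eq_mul,
    RingHom.id_apply, Complex.re_ofReal_mul]
  ring

theorem one (hB : ∀ v, 0 ≤ (B v v).re) : IsPosKernel B fun _ _ : ι => 1 := fun F => by
  convert hB (∑ a, F a) using 1
  simp only [one_mul, map_sum, LinearMap.sum_apply, Complex.re_sum]
  exact Finset.sum_comm

theorem agreeKernel_zero_mul (hk : IsPosKernel B k) (p : ι → Prop) [DecidablePred p] :
    IsPosKernel B fun a b => agreeKernel p 0 a b * k a b := by
  convert (hk.outer_mul fun a => if p a then 1 else 0).add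
    (hk.outer_mul fun a => if p a then 0 else 1) using 3 with a b
  by_cases ha : p a <;> by_cases hb : p b <;> simp [agreeKernel, ha, hb]

theorem agreeKernel_mul (hk : IsPosKernel B k) (p : ι → Prop) [DecidablePred p] {c : ℝ}
    (hc : |c| ≤ 1) : IsPosKernel B fun a b => agreeKernel p c a b * k a b := by
  obtain ⟨δ, hδ⟩ := agreeKernel_eq p c
  convert ((hk.agreeKernel_zero_mul p).const_mul (sub_nonneg.2 hc)).add
    ((hk.outer_mul δ).const_mul (abs_nonneg c)) using 3 with a b
  rw [hδ]
  ring

variable (χ : T → ι → Prop) [∀ t, DecidablePred (χ t)] {c : T → ℝ}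

theorem prod_agreeKernel (hB : ∀ v, 0 ≤ (B v v).re) (hc : ∀ t, |c t| ≤ 1) (s : Finset T) :
    IsPosKernel B fun a b => ∏ t ∈ s, agreeKernel (χ t) (c t) a b := by
  induction s using Finset.cons_induction with
  | empty => simpa using one hB
  | cons t s ht ih => simpa only [Finset.prod_cons] using ih.agreeKernel_mul (χ t) (hc t)

theorem prod_agreeKernel_sub (hB : ∀ v, 0 ≤ (B v v).re) (hc : ∀ t, |c t| ≤ 1) (s : Finset T) :
    IsPosKernel B fun a b => ∏ t ∈ s, agreeKernel (χ t) (c t) a b -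
      (∏ t ∈ s, (1 - |c t|)) * ∏ t ∈ s, agreeKernel (χ t) 0 a b := by
  induction s using Finset.cons_induction with
  | empty => intro F; simp
  | cons t s ht ih =>
    obtain ⟨δ, hδ⟩ := agreeKernel_eq (χ t) (c t)
    convert ((ih.agreeKernel_zero_mul (χ t)).const_mul (sub_nonneg.2 (hc t))).add
      (((prod_agreeKernel χ hB hc s).outer_mul δ).const_mul (abs_nonneg (c t))) using 3 with a b
    rw [Finset.prod_cons, Finset.prod_cons, Finset.prod_cons, hδ]
    ring

end IsPosKernel

theorem sum_prod_symmDiff_ge [Fintype T] [DecidableEq T] {B : V →ₗ⋆[ℂ] V →ₗ[ℂ] ℂ}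
    (hB : ∀ v, 0 ≤ (B v v).re) {χ : ι → Finset T} (hχ : Function.Injective χ) {c : T → ℝ}
    (hc : ∀ t, |c t| ≤ 1) (F : ι → V) :
    (∏ t, (1 - |c t|)) * ∑ a, (B (F a) (F a)).re ≤
      ∑ a, ∑ b, (∏ t ∈ χ a ∆ χ b, c t) * (B (F a) (F b)).re := by
  classical
  have agree_iff (a b : ι) (t : T) : (t ∈ χ a ↔ t ∈ χ b) ↔ t ∉ χ a ∆ χ b := by
    rw [Finset.mem_symmDiff]
    tauto
  have prod_eq (c : T → ℝ) (a b : ι) :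
      ∏ t, agreeKernel (fun a => t ∈ χ a) (c t) a b = ∏ t ∈ χ a ∆ χ b, c t := by
    simp only [agreeKernel, agree_iff, ite_not, Finset.prod_ite_mem, Finset.univ_inter]
  have prod_zero (a b : ι) : ∏ _t ∈ χ a ∆ χ b, (0 : ℝ) = if a = b then 1 else 0 := by
    rw [Finset.prod_const, zero_pow_eq]
    simp [hχ.eq_iff]
  have h := IsPosKernel.prod_agreeKernel_sub (fun t a => t ∈ χ a) hB hc Finset.univ F
  simp only [prod_eq, prod_zero, sub_mul, Finset.sum_sub_distrib, sub_nonneg,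
    mul_ite, mul_one, mul_zero, ite_mul, zero_mul, Finset.sum_ite_eq, Finset.mem_univ, if_true,
    ← Finset.mul_sum] at h
  exact h

end Kernel

section Tensor

variable {H : Type*} [NormedAddCommGroup H] [InnerProductSpace ℂ H] {n : ℕ}

/-! ### Positivity of the free inner product -/

theorem tensorInner_conj (f g : ⨂[ℂ]^n H) : conj (tensorInner n f g) = tensorInner n g f := by
  induction f using PiTensorProduct.induction_on with
  | add f f' h h' => simp only [map_add, LinearMap.add_apply, h, h']
  | smul_tprod r x =>
    induction g using PiTensorProduct.induction_on with
    | add g g' h h' => simp only [map_add, LinearMap.add_apply, h, h']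
    | smul_tprod s y => simp [tensorInner_tprod]; ring

theorem range_mapIncl_mono {W W' : Submodule ℂ H} (h : W ≤ W') :
    LinearMap.range (PiTensorProduct.mapIncl fun _ : Fin n => W) ≤
      LinearMap.range (PiTensorProduct.mapIncl fun _ : Fin n => W') := by
  have comp_eq : PiTensorProduct.mapIncl (fun _ : Fin n => W) =
      PiTensorProduct.mapIncl (fun _ : Fin n => W') ∘ₗ
        PiTensorProduct.map fun _ => Submodule.inclusion h := by
    rw [PiTensorProduct.mapIncl, PiTensorProduct.mapIncl, ← PiTensorProduct.map_comp]
    rfl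
  rw [comp_eq]
  exact LinearMap.range_comp_le_range _ _

theorem exists_finiteDimensional_mem_range_mapIncl (f : ⨂[ℂ]^n H) :
    ∃ W : Submodule ℂ H, FiniteDimensional ℂ W ∧
      f ∈ LinearMap.range (PiTensorProduct.mapIncl fun _ : Fin n => W) := by
  induction f using PiTensorProduct.induction_on with
  | smul_tprod r x =>
    refine ⟨Submodule.span ℂ (Set.range x), FiniteDimensional.span_of_finite ℂ
      (Set.finite_range x), Submodule.smul_mem _ r ⟨PiTensorProduct.tprod ℂ fun i =>
        ⟨x i, Submodule.subset_span ⟨i, rfl⟩⟩, ?_⟩⟩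
    simp [PiTensorProduct.mapIncl, PiTensorProduct.map_tprod]
  | add f g hf hg =>
    obtain ⟨W, _, hf⟩ := hf
    obtain ⟨W', _, hg⟩ := hg
    exact ⟨W ⊔ W', inferInstance,
      add_mem (range_mapIncl_mono le_sup_left hf) (range_mapIncl_mono le_sup_right hg)⟩

theorem exists_orthonormal_expansion (f : ⨂[ℂ]^n H) :
    ∃ (d : ℕ) (e : Fin d → H) (c : (Fin n → Fin d) → ℂ), Orthonormal ℂ e ∧
      f = ∑ I, c I • PiTensorProduct.tprod ℂ (e ∘ I) := by
  obtain ⟨W, _, g, rfl⟩ := exists_finiteDimensional_mem_range_mapIncl f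
  let b := stdOrthonormalBasis ℂ W
  let B := Basis.piTensorProduct fun _ : Fin n => b.toBasis
  refine ⟨_, fun i => (b i : H), B.repr g,
    b.orthonormal.comp_linearIsometry W.subtypeₗᵢ, ?_⟩
  conv_lhs => rw [← B.sum_repr g, map_sum]
  refine Finset.sum_congr rfl fun I _ => ?_
  simp [B, PiTensorProduct.mapIncl, PiTensorProduct.map_tprod, Function.comp_def]

theorem tensorInner_tprod_orthonormal {ι : Type*} [DecidableEq ι] {e : ι → H}
    (he : Orthonormal ℂ e) (I K : Fin n → ι) :
    tensorInner n (PiTensorProduct.tprod ℂ (e ∘ I)) (PiTensorProduct.tprod ℂ (e ∘ K)) =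
      if I = K then 1 else 0 := by
  simp only [tensorInner_tprod, Function.comp_apply, orthonormal_iff_ite.1 he,
    Fintype.prod_ite_zero, Finset.prod_const_one, funext_iff]

theorem tensorInner_self_eq_sum {d : ℕ} {e : Fin d → H} (he : Orthonormal ℂ e)
    (c : (Fin n → Fin d) → ℂ) :
    (tensorInner n (∑ I, c I • PiTensorProduct.tprod ℂ (e ∘ I))
      (∑ I, c I • PiTensorProduct.tprod ℂ (e ∘ I))).re = ∑ I, ‖c I‖ ^ 2 := by
  simp only [map_sum, LinearMap.sum_apply, map_smulₛₗ, LinearMap.smul_apply,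
    tensorInner_tprod_orthonormal he, smul_eq_mul, mul_ite, mul_one, mul_zero,
    Finset.sum_ite_eq', Finset.mem_univ, if_true, RingHom.id_apply, Complex.re_sum]
  exact Finset.sum_congr rfl fun I _ => by rw [Complex.mul_conj']; norm_cast

theorem tensorInner_self_pos {f : ⨂[ℂ]^n H} (hf : f ≠ 0) : 0 < (tensorInner n f f).re := by
  obtain ⟨d, e, c, he, rfl⟩ := exists_orthonormal_expansion f
  rw [tensorInner_self_eq_sum he]
  obtain ⟨I, hI⟩ : ∃ I, c I ≠ 0 := by
    by_contra! hc
    simp [hc] at hf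
  exact Finset.sum_pos' (fun _ _ => by positivity) ⟨I, Finset.mem_univ I, by positivity⟩

theorem tensorInner_self_nonneg (f : ⨂[ℂ]^n H) : 0 ≤ (tensorInner n f f).re := by
  rcases eq_or_ne f 0 with rfl | hf
  · simp
  · exact (tensorInner_self_pos hf).le

/-! ### The action of the hyperoctahedral group -/

/-- The vector `x_k` attached to a signed point, with the convention `x_{-k} = J x_k`. -/
def signedVec (J : H →ₗ[ℂ] H) (x : Fin n → H) (p : Fin n × ℤˣ) : H :=
  if p.2 = 1 then x p.1 else J (x p.1)

@[simp] theorem signedVec_one (J : H →ₗ[ℂ] H) (x : Fin n → H) (i : Fin n) :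
    signedVec J x (i, 1) = x i := by simp [signedVec]

@[simp] theorem signedVec_neg_one (J : H →ₗ[ℂ] H) (x : Fin n → H) (i : Fin n) :
    signedVec J x (i, -1) = J (x i) := by simp [signedVec]

theorem signedVec_opp {J : H →ₗ[ℂ] H} (hJ : Function.Involutive J) (x : Fin n → H)
    (p : Fin n × ℤˣ) : signedVec J x (opp p) = J (signedVec J x p) := by
  obtain ⟨i, s⟩ := p
  rcases Int.units_eq_one_or s with rfl | rfl <;> simp [opp, hJ _]

theorem signedVec_signedVec {J : H →ₗ[ℂ] H} (hJ : Function.Involutive J)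
    (τ : hyperoctahedral n) (x : Fin n → H) (p : Fin n × ℤˣ) :
    signedVec J (fun i => signedVec J x (τ.1 (i, 1))) p = signedVec J x (τ.1 p) := by
  obtain ⟨i, s⟩ := p
  rcases Int.units_eq_one_or s with rfl | rfl
  · simp
  · rw [signedVec_neg_one, ← signedVec_opp hJ, ← apply_opp]
    rfl

theorem apply_one_of_inv_apply {σ : hyperoctahedral n} {i j : Fin n} {s : ℤˣ}
    (h : σ⁻¹.1 (i, 1) = (j, s)) : σ.1 (j, 1) = (i, s) := by
  have hσ : σ.1 (j, s) = (i, 1) := (Equiv.Perm.inv_eq_iff_eq.1 h).symm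
  rcases Int.units_eq_one_or s with rfl | rfl
  · exact hσ
  · simpa [opp, hσ] using apply_opp σ (j, -1)

theorem action_tprod (J : H →ₗ[ℂ] H) (σ : hyperoctahedral n) (x : Fin n → H) :
    action J σ (PiTensorProduct.tprod ℂ x) =
      PiTensorProduct.tprod ℂ fun i => signedVec J x (σ⁻¹.1 (i, 1)) := by
  rw [action, LinearMap.comp_apply, PiTensorProduct.map_tprod, LinearEquiv.coe_coe,
    PiTensorProduct.reindex_tprod]
  congr 1
  ext i
  change (if (σ.1 ((σ⁻¹.1 (i, 1)).1, 1)).2 = 1 then LinearMap.id else J)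
    (x (σ⁻¹.1 (i, 1)).1) = _
  rcases h : σ⁻¹.1 (i, 1) with ⟨j, s⟩
  rw [apply_one_of_inv_apply h, signedVec]
  split_ifs <;> rfl

theorem action_mul {J : H →ₗ[ℂ] H} (hJ : Function.Involutive J) (σ τ : hyperoctahedral n)
    (f : ⨂[ℂ]^n H) : action J (σ * τ) f = action J σ (action J τ f) := by
  suffices action J (σ * τ) = action J σ ∘ₗ action J τ from LinearMap.congr_fun this f
  ext x
  simp only [LinearMap.compMultilinearMap_apply, LinearMap.comp_apply, action_tprod,
    signedVec_signedVec hJ]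
  rw [mul_inv_rev]
  rfl

theorem action_one (J : H →ₗ[ℂ] H) (f : ⨂[ℂ]^n H) :
    action J (1 : hyperoctahedral n) f = f := by
  suffices action J (1 : hyperoctahedral n) = LinearMap.id from LinearMap.congr_fun this f
  ext x
  simp [action_tprod]

theorem action_inv_apply {J : H →ₗ[ℂ] H} (hJ : Function.Involutive J) (σ : hyperoctahedral n)
    (f : ⨂[ℂ]^n H) : action J σ⁻¹ (action J σ f) = f := by
  rw [← action_mul hJ, inv_mul_cancel, action_one]

theorem tensorInner_action {J : H →ₗ[ℂ] H} (hJs : J.IsSymmetric) (σ : hyperoctahedral n)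
    (f g : ⨂[ℂ]^n H) : tensorInner n (action J σ f) g = tensorInner n f (action J σ⁻¹ g) := by
  induction f using PiTensorProduct.induction_on with
  | add f f' h h' => simp only [map_add, LinearMap.add_apply, h, h']
  | smul_tprod r x =>
    induction g using PiTensorProduct.induction_on with
    | add g g' h h' => simp only [map_add, h, h']
    | smul_tprod s y =>
      simp only [map_smulₛₗ, LinearMap.smul_apply, action_tprod, tensorInner_tprod, inv_inv]
      congr 2
      refine Fintype.prod_equiv (absPerm σ).symm _ _ fun i => ?_
      change _ = inner ℂ (x (σ⁻¹.1 (i, 1)).1) (signedVec J y (σ.1 ((σ⁻¹.1 (i, 1)).1, 1)))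
      rcases h : σ⁻¹.1 (i, 1) with ⟨j, s⟩
      rw [apply_one_of_inv_apply h, signedVec, signedVec]
      split_ifs
      · rfl
      · exact hJs _ _

/-! ### The deformed form on tensor powers -/

/-- The deformed form `⟨f, g⟩_{α,q} = ⟨f, P_{α,q}^{(n)} g⟩_{0,0}` on `H^{⊗n}`. -/
noncomputable def tensorForm (J : H →ₗ[ℂ] H) (α q : ℝ) (n : ℕ) :
    (⨂[ℂ]^n H) →ₗ⋆[ℂ] (⨂[ℂ]^n H) →ₗ[ℂ] ℂ :=
  (tensorInner n).compl₂ (symmetrization J α q n)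

theorem tensorForm_apply (J : H →ₗ[ℂ] H) (α q : ℝ) (f g : ⨂[ℂ]^n H) :
    tensorForm J α q n f g = tensorInner n f (symmetrization J α q n g) := rfl

theorem symmetrization_apply (J : H →ₗ[ℂ] H) (α q : ℝ) (f : ⨂[ℂ]^n H) :
    symmetrization J α q n f = ∑ σ, (weight α q σ : ℂ) • action J σ f := by
  simp [symmetrization, weight, LinearMap.sum_apply]

theorem tensorForm_eq_sum (J : H →ₗ[ℂ] H) (α q : ℝ) (f g : ⨂[ℂ]^n H) :
    tensorForm J α q n f g = ∑ σ, (weight α q σ : ℂ) * tensorInner n f (action J σ g) := by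
  simp [tensorForm_apply, symmetrization_apply]

theorem tensorForm_conj {J : H →ₗ[ℂ] H} (hJs : J.IsSymmetric) (α q : ℝ) (f g : ⨂[ℂ]^n H) :
    conj (tensorForm J α q n f g) = tensorForm J α q n g f := by
  simp only [tensorForm_eq_sum, map_sum, map_mul, Complex.conj_ofReal, tensorInner_conj,
    tensorInner_action hJs]
  exact Fintype.sum_equiv (Equiv.inv _) _ _ fun σ => by simp [weight_inv]

-- Averaging over the group turns the weights into the kernel `weight (σ⁻¹ τ)`.
theorem card_mul_tensorForm_self {J : H →ₗ[ℂ] H} (hJs : J.IsSymmetric)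
    (hJ : Function.Involutive J) (α q : ℝ) (f : ⨂[ℂ]^n H) :
    (Fintype.card (hyperoctahedral n) : ℝ) * (tensorForm J α q n f f).re =
      ∑ σ : hyperoctahedral n, ∑ τ : hyperoctahedral n,
        weight α q (σ⁻¹ * τ) * (tensorInner n (action J σ f) (action J τ f)).re := by
  rw [← nsmul_eq_mul, ← Finset.card_univ, ← Finset.sum_const]
  refine Finset.sum_congr rfl fun σ _ => ?_
  rw [tensorForm_eq_sum, Complex.re_sum]
  refine Fintype.sum_equiv (Equiv.mulLeft σ) _ _ fun ρ => ?_
  rw [Equiv.coe_mulLeft, inv_mul_cancel_left, tensorInner_action hJs, action_mul hJ,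
    action_inv_apply hJ, Complex.re_ofReal_mul]

theorem abs_rootParam_lt_one {α q : ℝ} (hα : |α| < 1) (hq : |q| < 1) (t : Root n) :
    |rootParam α q t| < 1 := by
  unfold rootParam
  split_ifs <;> assumption

theorem tensorForm_self_pos {J : H →ₗ[ℂ] H} (hJs : J.IsSymmetric) (hJ : Function.Involutive J)
    {α q : ℝ} (hα : |α| < 1) (hq : |q| < 1) {f : ⨂[ℂ]^n H} (hf : f ≠ 0) :
    0 < (tensorForm J α q n f f).re := by
  have hcard : (0 : ℝ) < Fintype.card (hyperoctahedral n) := by exact_mod_cast Fintype.card_pos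
  have hparam := abs_rootParam_lt_one (n := n) hα hq
  have hsum : ∑ σ : hyperoctahedral n, (tensorInner n (action J σ f) (action J σ f)).re =
      Fintype.card (hyperoctahedral n) * (tensorInner n f f).re := by
    simp only [tensorInner_action hJs, action_inv_apply hJ, Finset.sum_const, nsmul_eq_mul,
      Finset.card_univ]
  refine pos_of_mul_pos_right (a := (Fintype.card (hyperoctahedral n) : ℝ)) ?_ hcard.le
  calc (0 : ℝ) < (∏ t : Root n, (1 - |rootParam α q t|)) *
        ∑ σ : hyperoctahedral n, (tensorInner n (action J σ f) (action J σ f)).re := by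
        rw [hsum]
        exact mul_pos (Finset.prod_pos fun t _ => sub_pos.2 (hparam t))
          (mul_pos hcard (tensorInner_self_pos hf))
    _ ≤ _ := sum_prod_symmDiff_ge tensorInner_self_nonneg chamber_injective
        (fun t => (hparam t).le) fun σ => action J σ f
    _ = _ := by simp only [← weight_inv_mul, card_mul_tensorForm_self hJs hJ]

theorem tensorForm_self_nonneg {J : H →ₗ[ℂ] H} (hJs : J.IsSymmetric) (hJ : Function.Involutive J)
    {α q : ℝ} (hα : |α| < 1) (hq : |q| < 1) (f : ⨂[ℂ]^n H) :
    0 ≤ (tensorForm J α q n f f).re := by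
  rcases eq_or_ne f 0 with rfl | hf
  · simp
  · exact (tensorForm_self_pos hJs hJ hα hq hf).le

end Tensor

/-! ### Minimal coset representatives of `Σ(n)` in `Σ(n + 1)` -/

section Cosets

open scoped symmDiff

variable {n : ℕ}

theorem apply_eq (σ : hyperoctahedral n) (p : Fin n × ℤˣ) :
    σ.1 p = ((σ.1 (p.1, 1)).1, p.2 * (σ.1 (p.1, 1)).2) := by
  obtain ⟨i, s⟩ := p
  rcases Int.units_eq_one_or s with rfl | rfl
  · simp
  · simpa using σ.2 i 1

/-- The element of `Σ(n)` with prescribed images of the positive points `1, …, n`. -/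
noncomputable def ofImages (f : Fin n → Fin n × ℤˣ) (hf : Function.Injective fun i => (f i).1) :
    hyperoctahedral n :=
  ⟨Equiv.ofBijective (fun p => ((f p.1).1, p.2 * (f p.1).2)) (Finite.injective_iff_bijective.1 (by
    rintro ⟨i, s⟩ ⟨j, t⟩ h
    obtain rfl : i = j := hf (Prod.mk.inj h).1
    simpa using h)), fun i s => by simp⟩

theorem ofImages_apply (f : Fin n → Fin n × ℤˣ) (hf : Function.Injective fun i => (f i).1)
    (p : Fin n × ℤˣ) : (ofImages f hf).1 p = ((f p.1).1, p.2 * (f p.1).2) := rfl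

/-- The inclusion of the points of `Σ(n)` in those of `Σ(n + 1)`. -/
def castPoint (p : Fin n × ℤˣ) : Fin (n + 1) × ℤˣ := (p.1.castSucc, p.2)

@[simp] theorem signedVal_castPoint (p : Fin n × ℤˣ) : signedVal (castPoint p) = signedVal p := rfl

theorem castPoint_injective : Function.Injective (castPoint (n := n)) := fun p r h =>
  signedVal_injective (by rw [← signedVal_castPoint, h, signedVal_castPoint])

theorem castPoint_ne_last (p : Fin n × ℤˣ) (s : ℤˣ) : castPoint p ≠ (Fin.last n, s) :=
  fun h => (Fin.castSucc_lt_last p.1).ne (congrArg Prod.fst h)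

/-- The inclusion of `Σ(n)` in `Σ(n + 1)` as the stabilizer of `n + 1`. -/
noncomputable def extend (u : hyperoctahedral n) : hyperoctahedral (n + 1) :=
  ofImages (Fin.snoc (α := fun _ => Fin (n + 1) × ℤˣ) (fun i => castPoint (u.1 (i, 1)))
    (Fin.last n, 1)) (by
      change Function.Injective (Prod.fst ∘ _)
      rw [Fin.comp_snoc, Fin.snoc_injective_iff]
      refine ⟨(Fin.castSucc_injective n).comp (absPerm u).injective, ?_⟩
      rintro ⟨i, hi⟩
      exact (Fin.castSucc_lt_last _).ne hi)

@[simp] theorem extend_castPoint (u : hyperoctahedral n) (p : Fin n × ℤˣ) :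
    (extend u).1 (castPoint p) = castPoint (u.1 p) := by
  rw [apply_eq u p, extend, ofImages_apply]
  simp [castPoint]

@[simp] theorem extend_last (u : hyperoctahedral n) (s : ℤˣ) :
    (extend u).1 (Fin.last n, s) = (Fin.last n, s) := by
  simp [extend, ofImages_apply]

theorem extend_inv (u : hyperoctahedral n) : (extend u)⁻¹ = extend u⁻¹ := by
  rw [inv_eq_iff_mul_eq_one]
  refine ext_of_apply_one fun i => ?_
  change (extend u).1 ((extend u⁻¹).1 (i, 1)) = (i, 1)
  induction i using Fin.lastCases with
  | last => rw [extend_last, extend_last]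
  | cast i =>
    change (extend u).1 ((extend u⁻¹).1 (castPoint (i, 1))) = castPoint (i, 1)
    rw [extend_castPoint, extend_castPoint]
    exact congrArg castPoint (u.1.apply_symm_apply _)

theorem extend_injective : Function.Injective (extend (n := n)) := fun u v h =>
  ext_of_apply_one fun i => castPoint_injective (by
    rw [← extend_castPoint, h, extend_castPoint])

theorem exists_extend_eq {τ : hyperoctahedral (n + 1)}
    (h : τ.1 (Fin.last n, 1) = (Fin.last n, 1)) : ∃ u, extend u = τ := by
  have ne_last (i : Fin n) : (τ.1 (i.castSucc, 1)).1 ≠ Fin.last n := fun hi =>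
    (Fin.castSucc_lt_last i).ne ((fst_apply_eq_iff τ _ (Fin.last n, 1)).1 (by rw [hi, h]))
  refine ⟨ofImages (fun i => ((τ.1 (i.castSucc, 1)).1.castPred (ne_last i),
    (τ.1 (i.castSucc, 1)).2)) fun i j hij => ?_, ext_of_apply_one fun i => ?_⟩
  · exact Fin.castSucc_injective n ((absPerm τ).injective
      ((Fin.castPred_inj (hi := ne_last i) (hj := ne_last j)).1 hij))
  · induction i using Fin.lastCases with
    | last => rw [extend_last, h]
    | cast i => exact (extend_castPoint _ (i, 1)).trans (Prod.ext rfl (one_mul _))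

/-- The element of `Σ(n + 1)` that sends `n + 1` to `p`, and `1, …, n` increasingly to the
remaining positive points. -/
noncomputable def insertPoint (p : Fin (n + 1) × ℤˣ) : hyperoctahedral (n + 1) :=
  ofImages (Fin.snoc (α := fun _ => Fin (n + 1) × ℤˣ) (fun i => (p.1.succAbove i, 1)) p) (by
    change Function.Injective (Prod.fst ∘ _)
    rw [Fin.comp_snoc, Fin.snoc_injective_iff]
    refine ⟨p.1.succAbove_right_injective, ?_⟩
    rintro ⟨i, hi⟩
    exact p.1.succAbove_ne i hi)

@[simp] theorem insertPoint_castPoint (p : Fin (n + 1) × ℤˣ) (r : Fin n × ℤˣ) :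
    (insertPoint p).1 (castPoint r) = (p.1.succAbove r.1, r.2) := by
  simp [insertPoint, ofImages_apply, castPoint]

@[simp] theorem insertPoint_last (p : Fin (n + 1) × ℤˣ) (s : ℤˣ) :
    (insertPoint p).1 (Fin.last n, s) = (p.1, s * p.2) := by
  simp [insertPoint, ofImages_apply]

theorem extend_mul_insertPoint_inv_inv_apply_last (u : hyperoctahedral n)
    (p : Fin (n + 1) × ℤˣ) : (extend u * (insertPoint p)⁻¹)⁻¹.1 (Fin.last n, 1) = p := by
  rw [mul_inv_rev, inv_inv, extend_inv]
  change (insertPoint p).1 ((extend u⁻¹).1 (Fin.last n, 1)) = p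
  rw [extend_last, insertPoint_last, one_mul]

theorem extend_mul_insertPoint_inv_bijective (n : ℕ) : Function.Bijective
    fun x : hyperoctahedral n × (Fin (n + 1) × ℤˣ) => extend x.1 * (insertPoint x.2)⁻¹ := by
  constructor
  · rintro ⟨u, p⟩ ⟨v, r⟩ (h : extend u * (insertPoint p)⁻¹ = extend v * (insertPoint r)⁻¹)
    obtain rfl : p = r := by
      rw [← extend_mul_insertPoint_inv_inv_apply_last u p, h,
        extend_mul_insertPoint_inv_inv_apply_last]
    rw [extend_injective (mul_right_cancel h)]
  · intro σ
    have fixes_last : (σ * insertPoint (σ⁻¹.1 (Fin.last n, 1))).1 (Fin.last n, 1) =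
        (Fin.last n, 1) := by
      change σ.1 ((insertPoint (σ⁻¹.1 (Fin.last n, 1))).1 (Fin.last n, 1)) = _
      rw [insertPoint_last, one_mul]
      exact σ.1.apply_symm_apply _
    obtain ⟨u, hu⟩ := exists_extend_eq fixes_last
    exact ⟨(u, σ⁻¹.1 (Fin.last n, 1)), by simp only [hu, mul_inv_cancel_right]⟩

/-! ### Multiplicativity of the weight -/

theorem weight_eq_prod (α q : ℝ) (σ : hyperoctahedral n) :
    weight α q σ = ∏ t, if t ∈ chamber σ then 1 else rootParam α q t := by
  have chamber_one : chamber (1 : hyperoctahedral n) = ⊤ := by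
    refine Finset.eq_univ_iff_forall.2 fun t => mem_chamber.2 ?_
    rw [inv_one]
    exact t.2.1
  have h := weight_inv_mul α q 1 σ
  rw [inv_one, one_mul, chamber_one, top_symmDiff] at h
  rw [h, Finset.prod_ite, Finset.prod_const_one, one_mul]
  congr 1
  ext t
  simp

theorem weight_inv_mul_of_mem_chamber (α q : ℝ) {σ τ : hyperoctahedral n}
    (h : ∀ t, t ∈ chamber σ ∨ t ∈ chamber τ) :
    weight α q (σ⁻¹ * τ) = weight α q σ * weight α q τ := by
  rw [weight_inv_mul, weight_eq_prod, weight_eq_prod, ← Finset.prod_mul_distrib,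
    ← Fintype.prod_ite_mem]
  refine Finset.prod_congr rfl fun t _ => ?_
  rcases h t with ht | ht <;> simp [Finset.mem_symmDiff, ht]

/-- A root of `Σ(n)` as a root of `Σ(n + 1)`. -/
def castRoot (t : Root n) : Root (n + 1) := ⟨(castPoint t.1.1, castPoint t.1.2), t.2⟩

theorem neg_le_signedVal (p : Fin n × ℤˣ) : -(n : ℤ) ≤ signedVal p := by
  have := signedVal_le (opp p)
  rw [signedVal_opp] at this
  omega

/-- The root of `Σ(n + 1)` given by a point of `Σ(n)` and `n + 1`. -/
def lastRoot (p : Fin n × ℤˣ) : Root (n + 1) :=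
  ⟨(castPoint p, (Fin.last n, 1)), by
    have := signedVal_le p
    have := neg_le_signedVal p
    simp
    omega⟩

/-- The root of `Σ(n + 1)` given by `±(n + 1)`. -/
def shortLastRoot (n : ℕ) : Root (n + 1) :=
  ⟨((Fin.last n, -1), (Fin.last n, 1)), by simp; omega⟩

theorem root_cases (t : Root (n + 1)) :
    (∃ t', castRoot t' = t) ∨ (∃ p, lastRoot p = t) ∨ shortLastRoot n = t := by
  obtain ⟨⟨⟨i, s⟩, j, r⟩, hlt, hadd⟩ := t
  dsimp only at hlt hadd
  induction j using Fin.lastCases <;> induction i using Fin.lastCases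
  case last.last =>
    rcases Int.units_eq_one_or s with rfl | rfl <;> rcases Int.units_eq_one_or r with rfl | rfl <;>
      simp [shortLastRoot] at hlt hadd ⊢
    omega
  case last.cast i =>
    obtain rfl : r = 1 := by
      refine (Int.units_eq_one_or r).resolve_right ?_
      rintro rfl
      have : -(n : ℤ) ≤ signedVal (i.castSucc, s) := neg_le_signedVal (i, s)
      have : signedVal (i.castSucc, s) ≤ n := signedVal_le (i, s)
      simp only [signedVal_neg, signedVal_one, Fin.val_last] at hlt hadd
      omega
    exact Or.inr (Or.inl ⟨(i, s), rfl⟩)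
  case cast.last j =>
    have : signedVal (j.castSucc, r) ≤ n := signedVal_le (j, r)
    have : -(n : ℤ) ≤ signedVal (j.castSucc, r) := neg_le_signedVal (j, r)
    rcases Int.units_eq_one_or s with rfl | rfl <;>
      simp only [signedVal_neg, signedVal_one, Fin.val_last] at hlt hadd <;> omega
  case cast.cast j i => exact Or.inl ⟨⟨((i, s), (j, r)), hlt, hadd⟩, rfl⟩

theorem sumElim_castRoot_lastRoot_bijective (n : ℕ) : Function.Bijective
    (Sum.elim castRoot (Sum.elim lastRoot fun _ : Unit => shortLastRoot n)) := by
  constructor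
  · refine Function.Injective.sumElim ?_ (Function.Injective.sumElim ?_ ?_ ?_) ?_
    · intro t t' h
      have h' := Prod.mk.inj (congrArg Subtype.val h)
      exact Subtype.ext (Prod.ext (castPoint_injective h'.1) (castPoint_injective h'.2))
    · exact fun p p' h => castPoint_injective (Prod.mk.inj (congrArg Subtype.val h)).1
    · exact fun _ _ _ => rfl
    · exact fun p _ h => castPoint_ne_last _ _ (Prod.mk.inj (congrArg Subtype.val h)).1
    · rintro t (p | _) h <;>
        exact castPoint_ne_last _ _ (Prod.mk.inj (congrArg Subtype.val h)).2
  · intro t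
    rcases root_cases t with ⟨t', h⟩ | ⟨p, h⟩ | h
    · exact ⟨Sum.inl t', h⟩
    · exact ⟨Sum.inr (Sum.inl p), h⟩
    · exact ⟨Sum.inr (Sum.inr ()), h⟩

theorem prod_root_succ {M : Type*} [CommMonoid M] (F : Root (n + 1) → M) :
    ∏ t, F t = (∏ t, F (castRoot t)) *
      ((∏ i, F (lastRoot (i, 1)) * F (lastRoot (i, -1))) * F (shortLastRoot n)) := by
  rw [← (sumElim_castRoot_lastRoot_bijective n).prod_comp, Fintype.prod_sum_type,
    Fintype.prod_sum_type, Fintype.prod_prod_type]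
  simp

theorem rootParam_castRoot (α q : ℝ) (t : Root n) :
    rootParam α q (castRoot t) = rootParam α q t :=
  if_congr (Fin.castSucc_injective n).eq_iff rfl rfl

theorem rootParam_lastRoot (α q : ℝ) (p : Fin n × ℤˣ) : rootParam α q (lastRoot p) = q :=
  if_neg (Fin.castSucc_lt_last p.1).ne

theorem rootParam_shortLastRoot (α q : ℝ) (n : ℕ) : rootParam α q (shortLastRoot n) = α :=
  if_pos rfl

theorem castRoot_mem_chamber_extend (u : hyperoctahedral n) (t : Root n) :
    castRoot t ∈ chamber (extend u) ↔ t ∈ chamber u := by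
  simp only [mem_chamber, castRoot, extend_inv, extend_castPoint, signedVal_castPoint]

theorem lastRoot_mem_chamber_extend (u : hyperoctahedral n) (p : Fin n × ℤˣ) :
    lastRoot p ∈ chamber (extend u) := by
  have := signedVal_le (u⁻¹.1 p)
  simp only [mem_chamber, lastRoot, extend_inv, extend_castPoint, extend_last,
    signedVal_castPoint, signedVal_one, Fin.val_last]
  omega

theorem shortLastRoot_mem_chamber_extend (u : hyperoctahedral n) :
    shortLastRoot n ∈ chamber (extend u) := by
  simp only [mem_chamber, shortLastRoot, extend_inv, extend_last, signedVal_neg, signedVal_one,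
    Fin.val_last]
  omega

theorem signedVal_succAbove_lt (k : Fin (n + 1)) {a b : Fin n × ℤˣ}
    (h : signedVal a < signedVal b) :
    signedVal (k.succAbove a.1, a.2) < signedVal (k.succAbove b.1, b.2) := by
  obtain ⟨i, s⟩ := a
  obtain ⟨j, t⟩ := b
  have hij : k.succAbove i < k.succAbove j ↔ i < j := Fin.succAbove_lt_succAbove_iff
  have hji : k.succAbove j < k.succAbove i ↔ j < i := Fin.succAbove_lt_succAbove_iff
  simp only [Fin.lt_def] at hij hji
  rcases Int.units_eq_one_or s with rfl | rfl <;> rcases Int.units_eq_one_or t with rfl | rfl <;>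
    simp only [signedVal_neg, signedVal_one] at h ⊢ <;> omega

theorem castRoot_mem_chamber_insertPoint_inv (p : Fin (n + 1) × ℤˣ) (t : Root n) :
    castRoot t ∈ chamber (insertPoint p)⁻¹ := by
  rw [mem_chamber, inv_inv, castRoot, insertPoint_castPoint, insertPoint_castPoint]
  exact signedVal_succAbove_lt _ t.2.1

theorem lastRoot_mem_chamber_insertPoint_inv (p : Fin (n + 1) × ℤˣ) (r : Fin n × ℤˣ) :
    lastRoot r ∈ chamber (insertPoint p)⁻¹ ↔
      signedVal (p.1.succAbove r.1, r.2) < signedVal p := by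
  rw [mem_chamber, inv_inv, lastRoot, insertPoint_castPoint, insertPoint_last, one_mul]

theorem shortLastRoot_mem_chamber_insertPoint_inv (p : Fin (n + 1) × ℤˣ) :
    shortLastRoot n ∈ chamber (insertPoint p)⁻¹ ↔ p.2 = 1 := by
  obtain ⟨k, s⟩ := p
  rw [mem_chamber, inv_inv, shortLastRoot, insertPoint_last, insertPoint_last]
  rcases Int.units_eq_one_or s with rfl | rfl <;> simp <;> omega

theorem weight_extend (α q : ℝ) (u : hyperoctahedral n) :
    weight α q (extend u) = weight α q u := by
  rw [weight_eq_prod, prod_root_succ, weight_eq_prod]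
  simp only [castRoot_mem_chamber_extend, lastRoot_mem_chamber_extend,
    shortLastRoot_mem_chamber_extend, if_true, mul_one, Finset.prod_const_one, rootParam_castRoot]

theorem prod_ite_val_lt {M : Type*} [CommMonoid M] (a b : M) {k : ℕ} (hk : k ≤ n) :
    ∏ i : Fin n, (if i.val < k then a else b) = a ^ k * b ^ (n - k) := by
  have hcard := Finset.card_filter_add_card_filter_not (s := Finset.univ)
    fun i : Fin n => i.val < k
  rw [Fin.card_filter_val_lt, min_eq_right hk, Finset.card_univ, Fintype.card_fin] at hcard
  rw [Finset.prod_ite, Finset.prod_const, Finset.prod_const, Fin.card_filter_val_lt,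
    min_eq_right hk]
  congr 2
  omega

theorem weight_insertPoint_inv (α q : ℝ) (p : Fin (n + 1) × ℤˣ) :
    weight α q (insertPoint p)⁻¹ =
      (∏ i, (if signedVal (p.1.succAbove i, 1) < signedVal p then 1 else q) *
        (if signedVal (p.1.succAbove i, -1) < signedVal p then 1 else q)) *
      if p.2 = 1 then 1 else α := by
  rw [weight_eq_prod, prod_root_succ]
  simp only [castRoot_mem_chamber_insertPoint_inv, lastRoot_mem_chamber_insertPoint_inv,
    shortLastRoot_mem_chamber_insertPoint_inv, rootParam_lastRoot, rootParam_shortLastRoot,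
    if_true, Finset.prod_const_one, one_mul]

theorem weight_insertPoint_one_inv (α q : ℝ) (k : Fin (n + 1)) :
    weight α q (insertPoint (k, 1))⁻¹ = q ^ (n - k.val) := by
  have pos_lt_iff (i : Fin n) :
      signedVal (k.succAbove i, 1) < signedVal (k, 1) ↔ i.val < k.val := by
    have := Fin.succAbove_lt_iff_castSucc_lt k i
    simp only [Fin.lt_def, Fin.val_castSucc] at this
    simp only [signedVal_one]
    omega
  have neg_lt (i : Fin n) : signedVal (k.succAbove i, -1) < signedVal (k, 1) := by
    simp only [signedVal_one, signedVal_neg]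
    omega
  simp only [weight_insertPoint_inv, pos_lt_iff, neg_lt, if_true, mul_one]
  rw [prod_ite_val_lt 1 q (Nat.le_of_lt_succ k.2), one_pow, one_mul]

theorem weight_insertPoint_neg_one_inv (α q : ℝ) (k : Fin (n + 1)) :
    weight α q (insertPoint (k, -1))⁻¹ = α * q ^ (n + k.val) := by
  have not_pos_lt (i : Fin n) : ¬ signedVal (k.succAbove i, 1) < signedVal (k, -1) := by
    simp only [signedVal_one, signedVal_neg]
    omega
  have neg_lt_iff (i : Fin n) :
      signedVal (k.succAbove i, -1) < signedVal (k, -1) ↔ ¬ i.val < k.val := by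
    have := Fin.lt_succAbove_iff_le_castSucc k i
    simp only [Fin.lt_def, Fin.le_def, Fin.val_castSucc] at this
    simp only [signedVal_one, signedVal_neg]
    omega
  have neg_one_ne : (-1 : ℤˣ) ≠ 1 := by decide
  simp only [weight_insertPoint_inv, not_pos_lt, neg_lt_iff, neg_one_ne, if_false, ite_not]
  rw [Finset.prod_mul_distrib, prod_ite_val_lt q 1 (Nat.le_of_lt_succ k.2), Finset.prod_const,
    Finset.card_univ, Fintype.card_fin]
  ring

theorem weight_extend_mul (α q : ℝ) (u : hyperoctahedral n) (p : Fin (n + 1) × ℤˣ) :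
    weight α q (extend u * (insertPoint p)⁻¹) =
      weight α q u * weight α q (insertPoint p)⁻¹ := by
  have extend_eq : extend u = (extend u⁻¹)⁻¹ := by rw [extend_inv, inv_inv]
  rw [extend_eq, weight_inv_mul_of_mem_chamber, weight_extend, weight_inv]
  intro t
  rcases root_cases t with ⟨t', rfl⟩ | ⟨r, rfl⟩ | rfl
  · exact Or.inr (castRoot_mem_chamber_insertPoint_inv _ _)
  · exact Or.inl (lastRoot_mem_chamber_extend _ _)
  · exact Or.inl (shortLastRoot_mem_chamber_extend _)

end Cosets

section Annihilation

variable {H : Type*} [NormedAddCommGroup H] [InnerProductSpace ℂ H] {n : ℕ}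

/-! ### Creation and annihilation on tensor powers -/

/-- The creation operator `b*(x)` from `H^{⊗n}` to `H^{⊗(n+1)}`. -/
noncomputable def tensorCreation (x : H) (n : ℕ) : (⨂[ℂ]^n H) →ₗ[ℂ] (⨂[ℂ]^(n + 1) H) :=
  PiTensorProduct.lift ((LinearMap.applyₗ x).compMultilinearMap
    (PiTensorProduct.tprod ℂ : MultilinearMap ℂ (fun _ : Fin (n + 1) => H) _).curryRight)

theorem tensorCreation_tprod (x : H) (y : Fin n → H) :
    tensorCreation x n (PiTensorProduct.tprod ℂ y) =
      PiTensorProduct.tprod ℂ (Fin.snoc y x : Fin (n + 1) → H) := by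
  simp [tensorCreation]

/-- The contraction `y_1 ⊗ ⋯ ⊗ y_{n+1} ↦ ⟨x, y_{n+1}⟩ y_1 ⊗ ⋯ ⊗ y_n`, which is the adjoint of
`b*(x)` for the free inner product. -/
noncomputable def contractLast (x : H) (n : ℕ) : (⨂[ℂ]^(n + 1) H) →ₗ[ℂ] (⨂[ℂ]^n H) :=
  PiTensorProduct.lift (MultilinearMap.uncurryRight
    ((LinearMap.smulRightₗ (innerₛₗ ℂ x)).compMultilinearMap
      (PiTensorProduct.tprod ℂ : MultilinearMap ℂ (fun _ : Fin n => H) (⨂[ℂ]^n H))))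

theorem contractLast_tprod (x : H) (y : Fin (n + 1) → H) :
    contractLast x n (PiTensorProduct.tprod ℂ y) =
      inner ℂ x (y (Fin.last n)) • PiTensorProduct.tprod ℂ (Fin.init y) := by
  simp [contractLast]

theorem tensorInner_creation (x : H) (f : ⨂[ℂ]^n H) (g : ⨂[ℂ]^(n + 1) H) :
    tensorInner (n + 1) (tensorCreation x n f) g = tensorInner n f (contractLast x n g) := by
  induction f using PiTensorProduct.induction_on with
  | add f f' h h' => simp only [map_add, LinearMap.add_apply, h, h']
  | smul_tprod r y =>
    induction g using PiTensorProduct.induction_on with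
    | add g g' h h' => simp only [map_add, h, h']
    | smul_tprod s z =>
      simp only [map_smulₛₗ, LinearMap.smul_apply, tensorCreation_tprod, contractLast_tprod,
        tensorInner_tprod, Fin.prod_univ_castSucc, Fin.snoc_castSucc, Fin.snoc_last, Fin.init,
        smul_eq_mul, RingHom.id_apply]
      ring

theorem contractLast_action_extend (J : H →ₗ[ℂ] H) (x : H) (u : hyperoctahedral n)
    (g : ⨂[ℂ]^(n + 1) H) :
    contractLast x n (action J (extend u) g) = action J u (contractLast x n g) := by
  suffices contractLast x n ∘ₗ action J (extend u) = action J u ∘ₗ contractLast x n from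
    LinearMap.congr_fun this g
  ext y
  have extend_inv_castSucc (i : Fin n) :
      (extend u)⁻¹.1 (i.castSucc, 1) = castPoint (u⁻¹.1 (i, 1)) := by
    rw [extend_inv]
    exact extend_castPoint u⁻¹ (i, 1)
  simp only [LinearMap.compMultilinearMap_apply, LinearMap.comp_apply, action_tprod,
    contractLast_tprod, map_smul, extend_inv, extend_last, signedVec_one]
  congr 2
  ext i
  rw [Fin.init, ← extend_inv, extend_inv_castSucc]
  rfl

/-- The annihilation operator `b(x)` from `H^{⊗(n+1)}` to `H^{⊗n}`: the contraction composed with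
the sum `R` over the minimal coset representatives of `Σ(n)` in `Σ(n + 1)`. -/
noncomputable def tensorAnnihilation (J : H →ₗ[ℂ] H) (α q : ℝ) (x : H) (n : ℕ) :
    (⨂[ℂ]^(n + 1) H) →ₗ[ℂ] (⨂[ℂ]^n H) :=
  contractLast x n ∘ₗ
    ∑ p : Fin (n + 1) × ℤˣ, (weight α q (insertPoint p)⁻¹ : ℂ) • action J (insertPoint p)⁻¹

-- The factorization `P^{(n+1)} = (P^{(n)} ⊗ 1) R` along the cosets of `Σ(n)` in `Σ(n + 1)`.
theorem symmetrization_succ {J : H →ₗ[ℂ] H} (hJ : Function.Involutive J) (α q : ℝ)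
    (g : ⨂[ℂ]^(n + 1) H) :
    symmetrization J α q (n + 1) g = ∑ u : hyperoctahedral n, (weight α q u : ℂ) •
      action J (extend u) (∑ p : Fin (n + 1) × ℤˣ,
        (weight α q (insertPoint p)⁻¹ : ℂ) • action J (insertPoint p)⁻¹ g) := by
  rw [symmetrization_apply, ← (extend_mul_insertPoint_inv_bijective n).sum_comp,
    Fintype.sum_prod_type]
  simp only [map_sum, Finset.smul_sum, weight_extend_mul, action_mul hJ, map_smul, smul_smul,
    Complex.ofReal_mul]

theorem tensorForm_creation {J : H →ₗ[ℂ] H} (hJ : Function.Involutive J) (α q : ℝ) (x : H)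
    (f : ⨂[ℂ]^n H) (g : ⨂[ℂ]^(n + 1) H) :
    tensorForm J α q (n + 1) (tensorCreation x n f) g =
      tensorForm J α q n f (tensorAnnihilation J α q x n g) := by
  rw [tensorForm_apply, tensorInner_creation, symmetrization_succ hJ, tensorForm_apply,
    symmetrization_apply, map_sum]
  simp only [map_smul, contractLast_action_extend, tensorAnnihilation, LinearMap.comp_apply,
    LinearMap.sum_apply, LinearMap.smul_apply]

theorem contractLast_action_insertPoint_inv_tprod (J : H →ₗ[ℂ] H) (p : Fin (n + 1) × ℤˣ)
    (x : H) (y : Fin (n + 1) → H) :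
    contractLast x n (action J (insertPoint p)⁻¹ (PiTensorProduct.tprod ℂ y)) =
      inner ℂ x (signedVec J y p) • PiTensorProduct.tprod ℂ (y ∘ p.1.succAbove) := by
  rw [action_tprod, contractLast_tprod, inv_inv, insertPoint_last, one_mul]
  congr 2
  ext i
  have insertPoint_castSucc : (insertPoint p).1 (i.castSucc, 1) = (p.1.succAbove i, 1) :=
    insertPoint_castPoint p (i, 1)
  rw [Fin.init, insertPoint_castSucc, signedVec_one, Function.comp_apply]

theorem tensorAnnihilation_tprod (J : H →ₗ[ℂ] H) (α q : ℝ) (x : H) (y : Fin (n + 1) → H) :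
    tensorAnnihilation J α q x n (PiTensorProduct.tprod ℂ y) =
      ∑ k : Fin (n + 1), ((q : ℂ) ^ (n - k.val) * inner ℂ x (y k) +
        α * (q : ℂ) ^ (n + k.val) * inner ℂ x (J (y k))) •
          PiTensorProduct.tprod ℂ (y ∘ k.succAbove) := by
  simp only [tensorAnnihilation, LinearMap.comp_apply, LinearMap.sum_apply, LinearMap.smul_apply,
    map_sum, map_smul, contractLast_action_insertPoint_inv_tprod, Fintype.sum_prod_type]
  refine Finset.sum_congr rfl fun k _ => ?_
  have units_eq : (Finset.univ : Finset ℤˣ) = {1, -1} := by decide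
  rw [units_eq, Finset.sum_pair (by decide)]
  simp only [weight_insertPoint_one_inv, weight_insertPoint_neg_one_inv, signedVec_one,
    signedVec_neg_one, smul_smul, ← add_smul]
  push_cast
  rfl

theorem tensorAnnihilation_creation_zero (J : H →ₗ[ℂ] H) (α q : ℝ) (x y : H) (f : ⨂[ℂ]^0 H) :
    tensorAnnihilation J α q x 0 (tensorCreation y 0 f) =
      (inner ℂ x y + α * inner ℂ x (J y) : ℂ) • f := by
  suffices tensorAnnihilation J α q x 0 ∘ₗ tensorCreation y 0 =
      (inner ℂ x y + α * inner ℂ x (J y) : ℂ) • LinearMap.id from LinearMap.congr_fun this f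
  ext z
  simp only [LinearMap.compMultilinearMap_apply, LinearMap.comp_apply, tensorCreation_tprod,
    tensorAnnihilation_tprod, LinearMap.smul_apply, LinearMap.id_apply]
  rw [Fin.sum_univ_one, Subsingleton.elim (_ ∘ _) z]
  simp [Fin.snoc]

theorem snoc_comp_succAbove_castSucc {E : Type*} (z : Fin (n + 1) → E) (y : E) (k : Fin (n + 1)) :
    (Fin.snoc z y : Fin (n + 2) → E) ∘ k.castSucc.succAbove = Fin.snoc (z ∘ k.succAbove) y := by
  ext i
  induction i using Fin.lastCases <;> simp

theorem tensorAnnihilation_creation_succ (J : H →ₗ[ℂ] H) (α q : ℝ) (x y : H)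
    (f : ⨂[ℂ]^(n + 1) H) :
    tensorAnnihilation J α q x (n + 1) (tensorCreation y (n + 1) f) =
      (inner ℂ x y + α * (q : ℂ) ^ (2 * (n + 1)) * inner ℂ x (J y) : ℂ) • f +
        (q : ℂ) • tensorCreation y n (tensorAnnihilation J α q x n f) := by
  suffices tensorAnnihilation J α q x (n + 1) ∘ₗ tensorCreation y (n + 1) =
      (inner ℂ x y + α * (q : ℂ) ^ (2 * (n + 1)) * inner ℂ x (J y) : ℂ) • LinearMap.id +
        (q : ℂ) • tensorCreation y n ∘ₗ tensorAnnihilation J α q x n from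
    LinearMap.congr_fun this f
  ext z
  simp only [LinearMap.compMultilinearMap_apply, LinearMap.comp_apply, LinearMap.add_apply,
    LinearMap.smul_apply, LinearMap.id_apply, tensorCreation_tprod, tensorAnnihilation_tprod,
    Fin.sum_univ_castSucc (n := n + 1), map_sum, map_smul, Finset.smul_sum,
    snoc_comp_succAbove_castSucc, smul_smul]
  refine (add_comm _ _).trans ?_
  congr 1
  · simp [two_mul]
  · refine Finset.sum_congr rfl fun k _ => ?_
    have degree_eq : n + 1 - k.val = n - k.val + 1 := Nat.succ_sub (Fin.is_le k)
    simp only [Fin.snoc_castSucc, Fin.val_castSucc, degree_eq]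
    congr 1
    ring

end Annihilation

section Growth

variable {q a c : ℝ}

/-! ### The growth of the squared norms -/

/-- The solution `[n + 1]_q (a + c q^n)` of the recursion `g 0 = a + c`,
`g (n + 1) = a + c q^{2(n + 1)} + q g n`, which governs the squared norm of `b*(x)` on `H^{⊗n}`. -/
noncomputable def growth (q a c : ℝ) (n : ℕ) : ℝ :=
  (∑ k ∈ Finset.range (n + 1), q ^ k) * (a + c * q ^ n)

theorem growth_zero (q a c : ℝ) : growth q a c 0 = a + c := by simp [growth]

theorem growth_succ (q a c : ℝ) (n : ℕ) :
    growth q a c (n + 1) = a + c * q ^ (2 * (n + 1)) + q * growth q a c n := by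
  have sum_succ := Finset.sum_range_succ (fun k => q ^ k) (n + 1)
  have sum_succ' : ∑ k ∈ Finset.range (n + 2), q ^ k = q * ∑ k ∈ Finset.range (n + 1), q ^ k + 1 :=
    geom_sum_succ
  rw [growth, growth]
  linear_combination a * sum_succ' + c * q ^ (n + 1) * sum_succ

theorem one_sub_mul_growth (q a c : ℝ) (n : ℕ) :
    (1 - q) * growth q a c n = (1 - q ^ (n + 1)) * (a + c * q ^ n) := by
  rw [growth, ← mul_assoc, mul_neg_geom_sum]

theorem growth_pos (hq : 0 ≤ q) (ha : 0 < a) (hc : 0 ≤ c) (n : ℕ) : 0 < growth q a c n :=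
  mul_pos (geom_sum_pos hq n.succ_ne_zero) (by positivity)

theorem growth_le (hq : 0 ≤ q) (hq1 : q < 1) (ha : 0 ≤ a) (hc : 0 ≤ c) (n : ℕ) :
    growth q a c n ≤ (a + c) / (1 - q) := by
  rw [le_div_iff₀' (sub_pos.2 hq1), one_sub_mul_growth]
  calc (1 - q ^ (n + 1)) * (a + c * q ^ n) ≤ 1 * (a + c * 1) := by
        gcongr
        · linarith [pow_nonneg hq (n + 1)]
        · exact pow_le_one₀ hq hq1.le
    _ = a + c := by ring

theorem growth_le_of_le_mul (hq : 0 ≤ q) (hq1 : q < 1) (ha : 0 ≤ a) (hc : c ≤ q * a) (n : ℕ) :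
    growth q a c n ≤ a / (1 - q) := by
  rw [le_div_iff₀' (sub_pos.2 hq1), one_sub_mul_growth]
  calc (1 - q ^ (n + 1)) * (a + c * q ^ n) ≤ (1 - q ^ (n + 1)) * (a + q * a * q ^ n) := by
        gcongr
        linarith [pow_le_one₀ hq hq1.le (n := n + 1)]
    _ = a - a * (q ^ (n + 1)) ^ 2 := by ring
    _ ≤ a := sub_le_self _ (by positivity)

theorem tendsto_growth (hq : |q| < 1) (a c : ℝ) :
    Filter.Tendsto (growth q a c) Filter.atTop (nhds (a / (1 - q))) := by
  have tendsto_sum := (Filter.tendsto_add_atTop_iff_nat 1).2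
    (hasSum_geometric_of_abs_lt_one hq).tendsto_sum_nat
  have tendsto_pow := tendsto_pow_atTop_nhds_zero_of_abs_lt_one hq
  have limit_eq : a / (1 - q) = (1 - q)⁻¹ * (a + c * 0) := by ring
  rw [limit_eq]
  exact tendsto_sum.mul ((tendsto_pow.const_mul c).const_add a)

theorem exists_lt_growth (hq : 0 < q) (hq1 : q < 1) (ha : 0 ≤ a) (hc : q * a < c) :
    ∃ n, a / (1 - q) < growth q a c n := by
  have hc0 : 0 < c := (mul_nonneg hq.le ha).trans_lt hc
  obtain ⟨n, hn⟩ := exists_pow_lt_of_lt_one (div_pos (sub_pos.2 hc) hc0) hq1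
  rw [lt_div_iff₀ hc0] at hn
  refine ⟨n, ?_⟩
  rw [div_lt_iff₀' (sub_pos.2 hq1), one_sub_mul_growth]
  have pow_succ_mul_le : q ^ (n + 1) * c ≤ q ^ n * c :=
    mul_le_mul_of_nonneg_right (pow_le_pow_of_le_one hq.le hq1.le n.le_succ) hc0.le
  have excess_pos : 0 < q ^ n * (c - q * a - q ^ (n + 1) * c) :=
    mul_pos (pow_pos hq n) (by linarith)
  calc a < a + q ^ n * (c - q * a - q ^ (n + 1) * c) := lt_add_of_pos_right a excess_pos
    _ = (1 - q ^ (n + 1)) * (a + c * q ^ n) := by ring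

end Growth

section Involution

variable {H : Type*} [NormedAddCommGroup H] [InnerProductSpace ℂ H] {J : H →ₗ[ℂ] H}

/-! ### Bounds for creation on tensor powers -/

theorem inner_self_add_mul_inner_involution (hJs : J.IsSymmetric) (x : H) (c : ℝ) :
    (inner ℂ x x + c * inner ℂ x (J x) : ℂ) = (‖x‖ ^ 2 + c * (inner ℂ x (J x)).re : ℝ) := by
  have inner_real : (inner ℂ x (J x)).re = inner ℂ x (J x) :=
    Complex.conj_eq_iff_re.1 ((inner_conj_symm _ _).trans (hJs x x))
  rw [inner_self_eq_norm_sq_to_K]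
  push_cast
  rw [inner_real]
  rfl

theorem norm_involution (hJs : J.IsSymmetric) (hJ : Function.Involutive J) (x : H) :
    ‖J x‖ = ‖x‖ := by
  rw [@norm_eq_sqrt_re_inner ℂ, hJs, hJ, ← @norm_eq_sqrt_re_inner ℂ]

theorem mul_inner_involution_le (hJs : J.IsSymmetric) (hJ : Function.Involutive J) (α : ℝ)
    (x : H) : α * (inner ℂ x (J x)).re ≤ |α| * ‖x‖ ^ 2 :=
  calc α * (inner ℂ x (J x)).re ≤ |α| * |(inner ℂ x (J x)).re| :=
        (le_abs_self _).trans_eq (abs_mul _ _)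
    _ ≤ |α| * (‖x‖ * ‖J x‖) := by
        gcongr
        exact (Complex.abs_re_le_norm _).trans (norm_inner_le_norm _ _)
    _ = |α| * ‖x‖ ^ 2 := by rw [norm_involution hJs hJ, sq]

theorem re_form_adjoint_le {E F : Type*} [AddCommGroup F] [Module ℂ F]
    {A : E → E → ℂ} {B : F →ₗ⋆[ℂ] F →ₗ[ℂ] ℂ} (hconj : ∀ f g, conj (B f g) = B g f)
    (hnonneg : ∀ f, 0 ≤ (B f f).re) {T : E → F} {S : F → E} (hadj : ∀ f g, B (T f) g = A f (S g))
    {C : ℝ} (hC : 0 < C) (hT : ∀ f, (B (T f) (T f)).re ≤ C * (A f f).re) (g : F) :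
    (A (S g) (S g)).re ≤ C * (B g g).re := by
  have hconj_re : (B g (T (S g))).re = (A (S g) (S g)).re := by
    rw [← hconj, Complex.conj_re, hadj]
  have expand : (B ((C : ℂ) • g - T (S g)) ((C : ℂ) • g - T (S g))).re =
      C * (C * (B g g).re) - 2 * C * (A (S g) (S g)).re + (B (T (S g)) (T (S g))).re := by
    simp only [map_sub, map_smulₛₗ, LinearMap.sub_apply, LinearMap.smul_apply, smul_eq_mul,
      Complex.conj_ofReal, RingHom.id_apply, Complex.sub_re, Complex.re_ofReal_mul, hconj_re,
      hadj _ g]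
    ring
  have square_nonneg := hnonneg ((C : ℂ) • g - T (S g))
  refine le_of_mul_le_mul_left ?_ hC
  linarith [hT (S g)]

variable {α q : ℝ} {n : ℕ}

theorem tensorForm_creation_self_zero (hJs : J.IsSymmetric) (hJ : Function.Involutive J)
    (α q : ℝ) (x : H) (f : ⨂[ℂ]^0 H) :
    (tensorForm J α q 1 (tensorCreation x 0 f) (tensorCreation x 0 f)).re =
      (‖x‖ ^ 2 + α * (inner ℂ x (J x)).re) * (tensorForm J α q 0 f f).re := by
  rw [tensorForm_creation hJ, tensorAnnihilation_creation_zero,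
    inner_self_add_mul_inner_involution hJs, map_smul, smul_eq_mul, Complex.re_ofReal_mul]

theorem tensorForm_creation_self_succ (hJs : J.IsSymmetric) (hJ : Function.Involutive J)
    (α q : ℝ) (x : H) (f : ⨂[ℂ]^(n + 1) H) :
    (tensorForm J α q (n + 2) (tensorCreation x (n + 1) f) (tensorCreation x (n + 1) f)).re =
      (‖x‖ ^ 2 + α * q ^ (2 * (n + 1)) * (inner ℂ x (J x)).re) * (tensorForm J α q (n + 1) f f).re +
        q * (tensorForm J α q n (tensorAnnihilation J α q x n f)
          (tensorAnnihilation J α q x n f)).re := by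
  have scalar_eq := inner_self_add_mul_inner_involution hJs x (α * q ^ (2 * (n + 1)))
  rw [Complex.ofReal_mul, Complex.ofReal_pow] at scalar_eq
  rw [tensorForm_creation hJ, tensorAnnihilation_creation_succ, scalar_eq, map_add, map_smul,
    map_smul, smul_eq_mul, smul_eq_mul, Complex.add_re, Complex.re_ofReal_mul,
    Complex.re_ofReal_mul, ← tensorForm_conj hJs _ _ (tensorCreation _ _ _), Complex.conj_re,
    tensorForm_creation hJ]

theorem tensorForm_creation_le_of_nonpos (hJs : J.IsSymmetric) (hJ : Function.Involutive J)
    (hα : |α| < 1) (hq : |q| < 1) (hq0 : q ≤ 0) (x : H) (f : ⨂[ℂ]^n H) :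
    (tensorForm J α q (n + 1) (tensorCreation x n f) (tensorCreation x n f)).re ≤
      (‖x‖ ^ 2 + max (α * (inner ℂ x (J x)).re) 0) * (tensorForm J α q n f f).re := by
  have form_nonneg := tensorForm_self_nonneg hJs hJ hα hq f
  cases n with
  | zero =>
    rw [tensorForm_creation_self_zero hJs hJ]
    gcongr
    exact le_max_left _ _
  | succ n =>
    have annihilation_term_nonpos := mul_nonpos_of_nonpos_of_nonneg hq0
      (tensorForm_self_nonneg hJs hJ hα hq (tensorAnnihilation J α q x n f))
    have even_pow_nonneg : 0 ≤ q ^ (2 * (n + 1)) := (even_two_mul _).pow_nonneg q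
    have even_pow_le_one : q ^ (2 * (n + 1)) ≤ 1 := by
      rw [← (even_two_mul (n + 1)).pow_abs]
      exact pow_le_one₀ (abs_nonneg _) hq.le
    have coefficient_le : α * q ^ (2 * (n + 1)) * (inner ℂ x (J x)).re ≤
        max (α * (inner ℂ x (J x)).re) 0 :=
      calc α * q ^ (2 * (n + 1)) * (inner ℂ x (J x)).re
          = q ^ (2 * (n + 1)) * (α * (inner ℂ x (J x)).re) := by ring
        _ ≤ q ^ (2 * (n + 1)) * max (α * (inner ℂ x (J x)).re) 0 := by
            gcongr
            exact le_max_left _ _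
        _ ≤ max (α * (inner ℂ x (J x)).re) 0 :=
            mul_le_of_le_one_left (le_max_right _ _) even_pow_le_one
    rw [tensorForm_creation_self_succ hJs hJ]
    refine (add_le_of_nonpos_right annihilation_term_nonpos).trans ?_
    gcongr

theorem tensorForm_creation_le_growth (hJs : J.IsSymmetric) (hJ : Function.Involutive J)
    (hα : |α| < 1) (hq : |q| < 1) (hq0 : 0 ≤ q) {x : H} (hx : x ≠ 0) (f : ⨂[ℂ]^n H) :
    (tensorForm J α q (n + 1) (tensorCreation x n f) (tensorCreation x n f)).re ≤
      growth q (‖x‖ ^ 2) (|α| * ‖x‖ ^ 2) n * (tensorForm J α q n f f).re := by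
  have form_nonneg := tensorForm_self_nonneg hJs hJ hα hq f
  have inner_le := mul_inner_involution_le hJs hJ α x
  induction n with
  | zero =>
    rw [tensorForm_creation_self_zero hJs hJ, growth_zero]
    gcongr
  | succ n ih =>
    have hgrowth : 0 < growth q (‖x‖ ^ 2) (|α| * ‖x‖ ^ 2) n :=
      growth_pos hq0 (by positivity) (by positivity) n
    have annihilation_le := re_form_adjoint_le (tensorForm_conj hJs α q)
      (tensorForm_self_nonneg hJs hJ hα hq) (tensorForm_creation hJ α q x) hgrowth
      (fun f => ih f (tensorForm_self_nonneg hJs hJ hα hq f)) f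
    calc _ = (‖x‖ ^ 2 + α * (inner ℂ x (J x)).re * q ^ (2 * (n + 1))) *
            (tensorForm J α q (n + 1) f f).re + q * (tensorForm J α q n
              (tensorAnnihilation J α q x n f) (tensorAnnihilation J α q x n f)).re := by
          rw [tensorForm_creation_self_succ hJs hJ, mul_right_comm α]
      _ ≤ (‖x‖ ^ 2 + |α| * ‖x‖ ^ 2 * q ^ (2 * (n + 1))) * (tensorForm J α q (n + 1) f f).re +
            q * (growth q (‖x‖ ^ 2) (|α| * ‖x‖ ^ 2) n * (tensorForm J α q (n + 1) f f).re) := by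
          gcongr
      _ = _ := by rw [growth_succ]; ring

/-! ### Tensor powers of a vector -/

/-- The tensor power `x^{⊗n} = x ⊗ ⋯ ⊗ x`, the test vector for the lower bounds on `b*(x)`. -/
noncomputable def tensorPow (x : H) (n : ℕ) : ⨂[ℂ]^n H := PiTensorProduct.tprod ℂ fun _ => x

theorem tensorCreation_tensorPow (x : H) (n : ℕ) :
    tensorCreation x n (tensorPow x n) = tensorPow x (n + 1) := by
  rw [tensorPow, tensorCreation_tprod, tensorPow]
  congr 1
  ext i
  induction i using Fin.lastCases <;> simp

theorem tensorPow_ne_zero {x : H} (hx : x ≠ 0) (n : ℕ) : tensorPow x n ≠ 0 := by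
  intro h
  have inner_self : tensorInner n (tensorPow x n) (tensorPow x n) = inner ℂ x x ^ n := by
    simp [tensorPow, tensorInner_tprod]
  rw [h, map_zero] at inner_self
  exact pow_ne_zero n (inner_self_ne_zero.2 hx) inner_self.symm

theorem tensorAnnihilation_tensorPow (hJs : J.IsSymmetric) (α q : ℝ) (x : H) (n : ℕ) :
    tensorAnnihilation J α q x n (tensorPow x (n + 1)) =
      (growth q (‖x‖ ^ 2) (α * (inner ℂ x (J x)).re) n : ℂ) • tensorPow x n := by
  rw [← tensorCreation_tensorPow]
  induction n with
  | zero =>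
    rw [tensorAnnihilation_creation_zero, inner_self_add_mul_inner_involution hJs, growth_zero]
  | succ n ih =>
    have scalar_eq := inner_self_add_mul_inner_involution hJs x (α * q ^ (2 * (n + 1)))
    rw [Complex.ofReal_mul, Complex.ofReal_pow] at scalar_eq
    rw [tensorAnnihilation_creation_succ, scalar_eq, ← tensorCreation_tensorPow, ih, map_smul,
      smul_smul, ← add_smul, growth_succ]
    push_cast
    congr 1
    ring

theorem tensorForm_tensorPow_succ (hJs : J.IsSymmetric) (hJ : Function.Involutive J) (α q : ℝ)
    (x : H) (n : ℕ) :
    (tensorForm J α q (n + 1) (tensorPow x (n + 1)) (tensorPow x (n + 1))).re =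
      growth q (‖x‖ ^ 2) (α * (inner ℂ x (J x)).re) n *
        (tensorForm J α q n (tensorPow x n) (tensorPow x n)).re := by
  conv_lhs => rw [← tensorCreation_tensorPow, tensorForm_creation hJ, tensorCreation_tensorPow,
    tensorAnnihilation_tensorPow hJs, map_smul, smul_eq_mul, Complex.re_ofReal_mul]

end Involution

theorem div_sqrt_eq_sqrt_sq_div {a b : ℝ} (ha : 0 ≤ a) (hb : 0 ≤ b) : a / √b = √(a ^ 2 / b) := by
  rw [Real.sqrt_div' _ hb, Real.sqrt_sq ha]

section FockSpace

variable {H : Type*} [NormedAddCommGroup H] [InnerProductSpace ℂ H] {J : H →ₗ[ℂ] H} {α q : ℝ}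

/-! ### The deformed norm on the Fock space -/

theorem deformedInner_eq_sum (J : H →ₗ[ℂ] H) (α q : ℝ) {f : FockSpace H} (g : FockSpace H)
    {s : Finset ℕ} (hs : ∀ n, f n ≠ 0 → n ∈ s) :
    deformedInner J α q f g = ∑ n ∈ s, tensorForm J α q n (f n) (g n) := by
  classical
  refine Finset.sum_subset (fun n hn => hs n (by simpa using hn)) fun n _ hn => ?_
  have apply_eq_zero : f n = 0 := by simpa using hn
  simp only [apply_eq_zero, map_zero, LinearMap.zero_apply]

theorem exists_finset_of_apply_ne_zero (f : FockSpace H) :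
    ∃ s : Finset ℕ, ∀ n, f n ≠ 0 → n ∈ s := by
  classical exact ⟨f.support, by simp⟩

theorem deformedInner_conj (hJs : J.IsSymmetric) (α q : ℝ) (f g : FockSpace H) :
    conj (deformedInner J α q f g) = deformedInner J α q g f := by
  obtain ⟨s, hs⟩ := exists_finset_of_apply_ne_zero f
  obtain ⟨t, ht⟩ := exists_finset_of_apply_ne_zero g
  rw [deformedInner_eq_sum J α q g (s := s ∪ t) fun n hn => Finset.mem_union_left t (hs n hn),
    deformedInner_eq_sum J α q f (s := s ∪ t) fun n hn => Finset.mem_union_right s (ht n hn),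
    map_sum]
  exact Finset.sum_congr rfl fun n _ => tensorForm_conj hJs α q _ _

theorem deformedInner_self_pos (hJs : J.IsSymmetric) (hJ : Function.Involutive J) (hα : |α| < 1)
    (hq : |q| < 1) {f : FockSpace H} (hf : f ≠ 0) : 0 < (deformedInner J α q f f).re := by
  obtain ⟨s, hs⟩ := exists_finset_of_apply_ne_zero f
  obtain ⟨n, hn⟩ : ∃ n, f n ≠ 0 := by
    by_contra! hzero
    exact hf (DFinsupp.ext hzero)
  rw [deformedInner_eq_sum J α q f hs, Complex.re_sum]
  exact Finset.sum_pos' (fun n _ => tensorForm_self_nonneg hJs hJ hα hq _)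
    ⟨n, hs n hn, tensorForm_self_pos hJs hJ hα hq hn⟩

theorem creation_lof (x : H) (n : ℕ) (u : ⨂[ℂ]^n H) :
    creation x (DirectSum.lof ℂ ℕ (fun m => ⨂[ℂ]^m H) n u) =
      DirectSum.lof ℂ ℕ (fun m => ⨂[ℂ]^m H) (n + 1) (tensorCreation x n u) := by
  rw [creation, DirectSum.toModule_lof]
  rfl

theorem creation_apply_zero (x : H) (f : FockSpace H) : creation x f 0 = 0 := by
  suffices DirectSum.component ℂ ℕ (fun m => ⨂[ℂ]^m H) 0 ∘ₗ creation x = 0 from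
    LinearMap.congr_fun this f
  refine DirectSum.linearMap_ext ℂ fun n => LinearMap.ext fun u => ?_
  simp only [LinearMap.comp_apply, creation_lof]
  exact DirectSum.component.of ℂ _ _ _

theorem creation_apply_succ (x : H) (f : FockSpace H) (n : ℕ) :
    creation x f (n + 1) = tensorCreation x n (f n) := by
  suffices DirectSum.component ℂ ℕ (fun m => ⨂[ℂ]^m H) (n + 1) ∘ₗ creation x =
      tensorCreation x n ∘ₗ DirectSum.component ℂ ℕ (fun m => ⨂[ℂ]^m H) n from
    LinearMap.congr_fun this f
  refine DirectSum.linearMap_ext ℂ fun m => LinearMap.ext fun u => ?_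
  simp only [LinearMap.comp_apply, creation_lof]
  rcases eq_or_ne m n with rfl | hne
  · simp [DirectSum.component.lof_self]
  · simp [DirectSum.component.of, hne]

theorem fockNorm_nonneg (J : H →ₗ[ℂ] H) (α q : ℝ) (f : FockSpace H) : 0 ≤ fockNorm J α q f :=
  Real.sqrt_nonneg _

theorem fockNorm_lof (J : H →ₗ[ℂ] H) (α q : ℝ) (n : ℕ) (u : ⨂[ℂ]^n H) :
    fockNorm J α q (DirectSum.lof ℂ ℕ (fun m => ⨂[ℂ]^m H) n u) =
      √(tensorForm J α q n u u).re := by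
  rw [fockNorm, deformedInner_eq_sum J α q _ (s := {n}), Finset.sum_singleton, DirectSum.lof_apply]
  intro m hm
  by_contra hmem
  exact hm (DFinsupp.single_eq_of_ne (by simpa using hmem))

theorem fockNorm_creation_le {x : H} {C : ℝ} (hC : 0 ≤ C)
    (h : ∀ (n : ℕ) (f : ⨂[ℂ]^n H),
      (tensorForm J α q (n + 1) (tensorCreation x n f) (tensorCreation x n f)).re ≤
        C * (tensorForm J α q n f f).re) (f : FockSpace H) :
    fockNorm J α q (creation x f) ≤ √C * fockNorm J α q f := by
  obtain ⟨s, hs⟩ := exists_finset_of_apply_ne_zero f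
  have creation_support : ∀ m, creation x f m ≠ 0 → m ∈ s.map (addRightEmbedding 1) := by
    rintro (_ | m) hm
    · exact absurd (creation_apply_zero x f) hm
    · rw [creation_apply_succ] at hm
      exact Finset.mem_map_of_mem (addRightEmbedding 1)
        (hs m fun hzero => hm (by rw [hzero, map_zero]))
  rw [fockNorm, fockNorm, ← Real.sqrt_mul hC, deformedInner_eq_sum J α q f hs,
    deformedInner_eq_sum J α q _ creation_support, Finset.sum_map, Complex.re_sum, Complex.re_sum,
    Finset.mul_sum]
  refine Real.sqrt_le_sqrt (Finset.sum_le_sum fun n _ => ?_)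
  change (tensorForm J α q (n + 1) (creation x f (n + 1)) (creation x f (n + 1))).re ≤ _
  rw [creation_apply_succ]
  exact h n (f n)

/-! ### The operator norm -/

theorem opNorm_le {T : FockSpace H →ₗ[ℂ] FockSpace H} {c : ℝ} (hc : 0 ≤ c)
    (h : ∀ f, fockNorm J α q (T f) ≤ c * fockNorm J α q f) : opNorm J α q T ≤ c :=
  csInf_le ⟨0, fun _ hb => hb.1⟩ ⟨hc, h⟩

theorem fockNorm_le_opNorm_mul {T : FockSpace H →ₗ[ℂ] FockSpace H} (hT : IsBoundedOp J α q T)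
    (f : FockSpace H) : fockNorm J α q (T f) ≤ opNorm J α q T * fockNorm J α q f := by
  obtain ⟨c, hc⟩ := hT
  rcases (fockNorm_nonneg J α q f).eq_or_lt with hf | hf
  · have image_le := hc f
    rwa [← hf, mul_zero] at image_le ⊢
  · rw [← div_le_iff₀ hf]
    refine le_csInf ⟨|c|, abs_nonneg c, fun g => (hc g).trans ?_⟩ fun b hb =>
      (div_le_iff₀ hf).2 (hb.2 f)
    exact mul_le_mul_of_nonneg_right (le_abs_self c) (fockNorm_nonneg J α q g)

/-! ### The norm of the creation operator -/

theorem fockNorm_creation_le_of_nonpos (hJs : J.IsSymmetric) (hJ : Function.Involutive J)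
    (hα : |α| < 1) (hq : |q| < 1) (hq0 : q ≤ 0) (x : H) (f : FockSpace H) :
    fockNorm J α q (creation x f) ≤
      √(‖x‖ ^ 2 + max (α * (inner ℂ x (J x)).re) 0) * fockNorm J α q f :=
  fockNorm_creation_le (by positivity)
    (fun _ => tensorForm_creation_le_of_nonpos hJs hJ hα hq hq0 x) f

theorem fockNorm_creation_le_of_growth_le (hJs : J.IsSymmetric) (hJ : Function.Involutive J)
    (hα : |α| < 1) (hq : |q| < 1) (hq0 : 0 ≤ q) {x : H} (hx : x ≠ 0) {C : ℝ} (hC : 0 ≤ C)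
    (h : ∀ n, growth q (‖x‖ ^ 2) (|α| * ‖x‖ ^ 2) n ≤ C) (f : FockSpace H) :
    fockNorm J α q (creation x f) ≤ √C * fockNorm J α q f :=
  fockNorm_creation_le hC (fun n f =>
    (tensorForm_creation_le_growth hJs hJ hα hq hq0 hx f).trans
      (mul_le_mul_of_nonneg_right (h n) (tensorForm_self_nonneg hJs hJ hα hq f))) f

theorem fockNorm_creation_le_of_nonneg (hJs : J.IsSymmetric) (hJ : Function.Involutive J)
    (hα : |α| < 1) (hq : |q| < 1) (hq0 : 0 ≤ q) {x : H} (hx : x ≠ 0) (f : FockSpace H) :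
    fockNorm J α q (creation x f) ≤ √((1 + |α|) / (1 - q)) * ‖x‖ * fockNorm J α q f := by
  have hq1 : q < 1 := lt_of_abs_lt hq
  have const_eq : √((1 + |α|) / (1 - q)) * ‖x‖ =
      √((‖x‖ ^ 2 + |α| * ‖x‖ ^ 2) / (1 - q)) := by
    have factor : (‖x‖ ^ 2 + |α| * ‖x‖ ^ 2) / (1 - q) = (1 + |α|) / (1 - q) * ‖x‖ ^ 2 := by ring
    rw [factor, Real.sqrt_mul' _ (sq_nonneg _), Real.sqrt_sq (norm_nonneg x)]
  rw [const_eq]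
  exact fockNorm_creation_le_of_growth_le hJs hJ hα hq hq0 hx
    (div_nonneg (by positivity) (sub_pos.2 hq1).le)
    (growth_le hq0 hq1 (by positivity) (by positivity)) f

theorem isBoundedOp_creation (hJs : J.IsSymmetric) (hJ : Function.Involutive J) (hα : |α| < 1)
    (hq : |q| < 1) {x : H} (hx : x ≠ 0) : IsBoundedOp J α q (creation x) := by
  rcases le_total q 0 with hq0 | hq0
  · exact ⟨_, fockNorm_creation_le_of_nonpos hJs hJ hα hq hq0 x⟩
  · exact ⟨_, fockNorm_creation_le_of_nonneg hJs hJ hα hq hq0 hx⟩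

theorem opNorm_creation_le_of_nonpos (hJs : J.IsSymmetric) (hJ : Function.Involutive J)
    (hα : |α| < 1) (hq : |q| < 1) (hq0 : q ≤ 0) (x : H) :
    opNorm J α q (creation x) ≤ √(‖x‖ ^ 2 + max (α * (inner ℂ x (J x)).re) 0) :=
  opNorm_le (Real.sqrt_nonneg _) (fockNorm_creation_le_of_nonpos hJs hJ hα hq hq0 x)

theorem opNorm_creation_le_of_nonneg (hJs : J.IsSymmetric) (hJ : Function.Involutive J)
    (hα : |α| < 1) (hq : |q| < 1) (hq0 : 0 ≤ q) {x : H} (hx : x ≠ 0) :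
    opNorm J α q (creation x) ≤ √((1 + |α|) / (1 - q)) * ‖x‖ :=
  opNorm_le (by positivity) (fockNorm_creation_le_of_nonneg hJs hJ hα hq hq0 hx)

theorem opNorm_creation_le_of_abs_le (hJs : J.IsSymmetric) (hJ : Function.Involutive J)
    (hα : |α| < 1) (hq : |q| < 1) (hαq : |α| ≤ q) {x : H} (hx : x ≠ 0) :
    opNorm J α q (creation x) ≤ ‖x‖ / √(1 - q) := by
  have hq1 : q < 1 := lt_of_abs_lt hq
  have hq0 : 0 ≤ q := (abs_nonneg α).trans hαq
  rw [div_sqrt_eq_sqrt_sq_div (norm_nonneg x) (sub_pos.2 hq1).le]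
  refine opNorm_le (Real.sqrt_nonneg _) (fockNorm_creation_le_of_growth_le hJs hJ hα hq hq0 hx
    (div_nonneg (by positivity) (sub_pos.2 hq1).le)
    (growth_le_of_le_mul hq0 hq1 (by positivity) ?_))
  gcongr

theorem sqrt_growth_le_opNorm_creation (hJs : J.IsSymmetric) (hJ : Function.Involutive J)
    (hα : |α| < 1) (hq : |q| < 1) {x : H} (hx : x ≠ 0) (n : ℕ) :
    √(growth q (‖x‖ ^ 2) (α * (inner ℂ x (J x)).re) n) ≤ opNorm J α q (creation x) := by
  have form_pos : 0 < (tensorForm J α q n (tensorPow x n) (tensorPow x n)).re :=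
    tensorForm_self_pos hJs hJ hα hq (tensorPow_ne_zero hx n)
  have creation_le := fockNorm_le_opNorm_mul (isBoundedOp_creation hJs hJ hα hq hx)
    (DirectSum.lof ℂ ℕ (fun m => ⨂[ℂ]^m H) n (tensorPow x n))
  rw [creation_lof, tensorCreation_tensorPow, fockNorm_lof, fockNorm_lof,
    tensorForm_tensorPow_succ hJs hJ, Real.sqrt_mul' _ form_pos.le] at creation_le
  exact le_of_mul_le_mul_right creation_le (Real.sqrt_pos.2 form_pos)

theorem sqrt_norm_sq_add_le_opNorm_creation (hJs : J.IsSymmetric) (hJ : Function.Involutive J)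
    (hα : |α| < 1) (hq : |q| < 1) {x : H} (hx : x ≠ 0) :
    √(‖x‖ ^ 2 + α * (inner ℂ x (J x)).re) ≤ opNorm J α q (creation x) := by
  rw [← growth_zero q]
  exact sqrt_growth_le_opNorm_creation hJs hJ hα hq hx 0

theorem norm_div_sqrt_le_opNorm_creation (hJs : J.IsSymmetric) (hJ : Function.Involutive J)
    (hα : |α| < 1) (hq : |q| < 1) {x : H} (hx : x ≠ 0) :
    ‖x‖ / √(1 - q) ≤ opNorm J α q (creation x) := by
  rw [div_sqrt_eq_sqrt_sq_div (norm_nonneg x) (sub_pos.2 (lt_of_abs_lt hq)).le]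
  exact le_of_tendsto' (tendsto_growth hq _ _).sqrt
    (sqrt_growth_le_opNorm_creation hJs hJ hα hq hx)

theorem norm_div_sqrt_lt_opNorm_creation (hJs : J.IsSymmetric) (hJ : Function.Involutive J)
    (hα : |α| < 1) (hq : |q| < 1) {x : H} (hx : x ≠ 0) (hq0 : 0 < q)
    (hlt : q < α * (inner ℂ x (J x)).re / ‖x‖ ^ 2) :
    ‖x‖ / √(1 - q) < opNorm J α q (creation x) := by
  have hq1 : q < 1 := lt_of_abs_lt hq
  obtain ⟨n, hn⟩ := exists_lt_growth hq0 hq1 (sq_nonneg ‖x‖) ((lt_div_iff₀ (by positivity)).1 hlt)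
  rw [div_sqrt_eq_sqrt_sq_div (norm_nonneg x) (sub_pos.2 hq1).le]
  exact (Real.sqrt_lt_sqrt (div_nonneg (sq_nonneg _) (sub_pos.2 hq1).le) hn).trans_le
    (sqrt_growth_le_opNorm_creation hJs hJ hα hq hx n)

end FockSpace

end TypeB

theorem mainTheorem5_general {H : Type*} [NormedAddCommGroup H] [InnerProductSpace ℂ H]
    (J : H →ₗ[ℂ] H) (hJ_selfAdjoint : J.IsSymmetric) (hJ_involution : ∀ x, J (J x) = x)
    (α q : ℝ) (hα : |α| < 1) (hq : |q| < 1) (x : H) (hx : x ≠ 0) :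
    ((∀ f g : TypeB.FockSpace H,
        starRingEnd ℂ (TypeB.deformedInner J α q f g) = TypeB.deformedInner J α q g f) ∧
      (∀ f : TypeB.FockSpace H, f ≠ 0 → 0 < (TypeB.deformedInner J α q f f).re)) ∧
    TypeB.IsBoundedOp J α q (TypeB.creation x) ∧
    (q ≤ 0 → 0 ≤ α * (inner ℂ x (J x)).re →
      TypeB.opNorm J α q (TypeB.creation x) = √(‖x‖ ^ 2 + α * (inner ℂ x (J x)).re)) ∧
    (q ≤ 0 → α * (inner ℂ x (J x)).re < 0 →
      ‖x‖ / √(1 - q) ≤ TypeB.opNorm J α q (TypeB.creation x) ∧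
      TypeB.opNorm J α q (TypeB.creation x) ≤ ‖x‖) ∧
    (|α| ≤ q → TypeB.opNorm J α q (TypeB.creation x) = ‖x‖ / √(1 - q)) ∧
    (0 < q → q < α * (inner ℂ x (J x)).re / ‖x‖ ^ 2 →
      ‖x‖ / √(1 - q) < TypeB.opNorm J α q (TypeB.creation x) ∧
      TypeB.opNorm J α q (TypeB.creation x) ≤ √((1 + |α|) / (1 - q)) * ‖x‖) ∧
    (¬ (q ≤ 0 ∧ 0 ≤ α * (inner ℂ x (J x)).re) →
      ¬ (q ≤ 0 ∧ α * (inner ℂ x (J x)).re < 0) →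
      ¬ (|α| ≤ q) →
      ¬ (0 < q ∧ q < α * (inner ℂ x (J x)).re / ‖x‖ ^ 2) →
      ‖x‖ / √(1 - q) ≤ TypeB.opNorm J α q (TypeB.creation x) ∧
      TypeB.opNorm J α q (TypeB.creation x) ≤ √((1 + |α|) / (1 - q)) * ‖x‖) := by
  have lower := TypeB.norm_div_sqrt_le_opNorm_creation hJ_selfAdjoint hJ_involution hα hq hx
  have upper_nonpos (hq0 : q ≤ 0) :=
    TypeB.opNorm_creation_le_of_nonpos hJ_selfAdjoint hJ_involution hα hq hq0 x
  have upper_nonneg (hq0 : 0 ≤ q) :=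
    TypeB.opNorm_creation_le_of_nonneg hJ_selfAdjoint hJ_involution hα hq hq0 hx
  refine ⟨⟨TypeB.deformedInner_conj hJ_selfAdjoint α q, fun f hf =>
      TypeB.deformedInner_self_pos hJ_selfAdjoint hJ_involution hα hq hf⟩,
    TypeB.isBoundedOp_creation hJ_selfAdjoint hJ_involution hα hq hx,
    fun hq0 hβ => le_antisymm ?_
      (TypeB.sqrt_norm_sq_add_le_opNorm_creation hJ_selfAdjoint hJ_involution hα hq hx),
    fun hq0 hβ => ⟨lower, ?_⟩,
    fun hαq => le_antisymm
      (TypeB.opNorm_creation_le_of_abs_le hJ_selfAdjoint hJ_involution hα hq hαq hx) lower,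
    fun hq0 hlt => ⟨TypeB.norm_div_sqrt_lt_opNorm_creation hJ_selfAdjoint hJ_involution hα hq hx
      hq0 hlt, upper_nonneg hq0.le⟩,
    fun hcase₁ hcase₂ _ _ => ⟨lower, upper_nonneg ?_⟩⟩
  · simpa only [max_eq_left hβ] using upper_nonpos hq0
  · simpa only [max_eq_right hβ.le, add_zero, Real.sqrt_sq (norm_nonneg x)] using upper_nonpos hq0
  · by_contra! hq0
    exact (le_or_gt 0 _).elim (fun hβ => hcase₁ ⟨hq0.le, hβ⟩) fun hβ => hcase₂ ⟨hq0.le, hβ⟩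

theorem mainTheorem5 {H : Type*} [NormedAddCommGroup H] [InnerProductSpace ℂ H] [CompleteSpace H]
    (J : H →ₗ[ℂ] H) (hJ_selfAdjoint : J.IsSymmetric) (hJ_involution : ∀ x, J (J x) = x)
    (α q : ℝ) (hα : |α| < 1) (hq : |q| < 1) (x : H) (hx : x ≠ 0) :
    -- `⟨·, ·⟩_{α,q}` is an inner product, for which `b*(x)` is bounded
    ((∀ f g : TypeB.FockSpace H,
        starRingEnd ℂ (TypeB.deformedInner J α q f g) = TypeB.deformedInner J α q g f) ∧
      (∀ f : TypeB.FockSpace H, f ≠ 0 → 0 < (TypeB.deformedInner J α q f f).re)) ∧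
    TypeB.IsBoundedOp J α q (TypeB.creation x) ∧
    (q ≤ 0 → 0 ≤ α * (inner ℂ x (J x)).re →
      TypeB.opNorm J α q (TypeB.creation x) = √(‖x‖ ^ 2 + α * (inner ℂ x (J x)).re)) ∧
    (q ≤ 0 → α * (inner ℂ x (J x)).re < 0 →
      ‖x‖ / √(1 - q) ≤ TypeB.opNorm J α q (TypeB.creation x) ∧
      TypeB.opNorm J α q (TypeB.creation x) ≤ ‖x‖) ∧
    (|α| ≤ q → TypeB.opNorm J α q (TypeB.creation x) = ‖x‖ / √(1 - q)) ∧
    (0 < q → q < α * (inner ℂ x (J x)).re / ‖x‖ ^ 2 →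
      ‖x‖ / √(1 - q) < TypeB.opNorm J α q (TypeB.creation x) ∧
      TypeB.opNorm J α q (TypeB.creation x) ≤ √((1 + |α|) / (1 - q)) * ‖x‖) ∧
    (¬ (q ≤ 0 ∧ 0 ≤ α * (inner ℂ x (J x)).re) →
      ¬ (q ≤ 0 ∧ α * (inner ℂ x (J x)).re < 0) →
      ¬ (|α| ≤ q) →
      ¬ (0 < q ∧ q < α * (inner ℂ x (J x)).re / ‖x‖ ^ 2) →
      ‖x‖ / √(1 - q) ≤ TypeB.opNorm J α q (TypeB.creation x) ∧
      TypeB.opNorm J α q (TypeB.creation x) ≤ √((1 + |α|) / (1 - q)) * ‖x‖) := by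
  exact mainTheorem5_general J hJ_selfAdjoint hJ_involution α q hα hq x hx
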